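/- Let $K$ be a number field, $X$ a smooth, absolutely irreducible, projective curve over $K$, $\eta\in X(K)$, $Y=X\setminus\{\eta\}$, $F=K(X)$, and let $A\subset F$ be the ring of rational functions on $X$ that are regular on $Y$; for $0\ne g\in F$ put $\deg(g)=-\operatorname{ord}_\eta(g)$. Let $P,Q\in A[x]$ be such that the resultant $\operatorname{Res}(P,Q)$ and the leading coefficients of $P$ and of $Q$ are nonzero constants (elements of $K^*$), let $\mathbf f=P/Q\in F(x)$ be of degree $d=\max(\deg_xP,\deg_xQ)\ge 2$, and suppose that $\infty$ is a superattracting periodic point of $\mathbf f$, i.e. for some $n\ge1$ the iterate $\mathbf f^n$ fixes $\infty$ and has derivative $0$ there (in the coordinate $1/x$). Let $\mathbf c=[\mathbf a:\mathbf b]\in\mathbb P^1(F)$, where $\mathbf a,\mathbf b\in A$ generate the unit ideal of $A$, and suppose that the degrees $\deg(\mathbf f^n(\mathbf c))$, over the $n\ge0$ with $\mathbf f^n(\mathbf c)\neq 0,\infty$, are not bounded above. For $\lambda\in Y(\bar K)$ let $\mathbf f_\lambda=P_\lambda/Q_\lambda$ be obtained by evaluating the coefficients of $P$ and $Q$ at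 $\lambda$, and let $\mathbf c(\lambda)=[\mathbf a(\lambda):\mathbf b(\lambda)]$. Then the canonical heights $$\hat h_{\mathbf f}(\mathbf c)=\lim_{n\to\infty}\frac{h_F(\mathbf f^n(\mathbf c))}{d^n},\qquad \hat h_{\mathbf f_\lambda}(\mathbf c(\lambda))=\lim_{n\to\infty}\frac{h_{\bar K}(\mathbf f_\lambda^n(\mathbf c(\lambda)))}{d^n}\quad(\lambda\in Y(\bar K))$$ exist, where $h_{\bar K}$ is the absolute logarithmic Weil height on $\mathbb P^1(\bar K)$ and $h_F([x_0:x_1])=\sum_{p}[K(p):K]\max_i(-\operatorname{ord}_p x_i)$, the sum being over the closed points $p$ of $X$, with residue fields $K(p)$. Moreover, for every Weil height $h$ on $X(\bar K)$ associated to the divisor class of $\eta$, $$\hat h_{\mathbf f_\lambda}(\mathbf c(\lambda))=\hat h_{\mathbf f}(\mathbf c)\,h(\lambda)+O(1)\qquad\text{for all }\lambda\in Y(\bar K),$$ where the implied constant does not depend on $\lambda$. -/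

import Mathlib

open Polynomial Filter Topology
open scoped WithZero

noncomputable section

/-! ### Curves over a number field, through their function fields

A smooth, absolutely irreducible, projective curve `X` over a field `K` of characteristic zero is
given by its function field `F = K(X)`.  Its closed points are the places of `F / K`,
i.e. the discrete valuation rings of `F / K` (the local rings of the closed points of `X`). -/

/-- `F` is the function field of a smooth, absolutely irreducible, projective curve over `K`
(for `K` of characteristic zero): it is a finitely generated field extension of transcendence
degree one in which `K` is algebraically closed. -/
structure IsCurveFunctionField (K F : Type*) [Field K] [Field F] [Algebra K F] : Prop where
  fg : (⊤ : IntermediateField K F).FG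
  trdeg_eq_one : Algebra.trdeg K F = 1
  algClosed : algebraicClosure K F = ⊥

/-- A closed point of the curve with function field `F / K`, given by its local ring:
a discrete valuation ring containing `K` with fraction field `F`. -/
@[ext]
structure Place (K F : Type*) [Field K] [Field F] [Algebra K F] where
  ring : Subalgebra K F
  isDVR : IsDiscreteValuationRing ring
  isFractionRing : IsFractionRing ring F

namespace Place

variable {K F : Type*} [Field K] [Field F] [Algebra K F]

instance (p : Place K F) : IsDiscreteValuationRing p.ring := p.isDVR

instance (p : Place K F) : IsFractionRing p.ring F := p.isFractionRing

/-- The valuation of `F` at the closed point `p`, normalised so that a uniformizer has value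
`exp (-1)`; that is, `p.val x = exp (- ord_p x)` for `x ≠ 0`, and `p.val 0 = 0`. -/
def val (p : Place K F) : Valuation F ℤᵐ⁰ :=
  (IsDiscreteValuationRing.maximalIdeal p.ring).valuation F

/-- The degree over `K` of the residue field of the closed point `p`. -/
def degree (p : Place K F) : ℕ := Module.finrank K (IsLocalRing.ResidueField p.ring)

/-- The ring of functions that are regular away from `η`. -/
def regularRing (η : Place K F) : Subalgebra K F :=
  ⨅ (p : Place K F) (_ : p ≠ η), p.ring

theorem regularRing_le {η p : Place K F} (h : p ≠ η) : η.regularRing ≤ p.ring :=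
  iInf₂_le p h

/-- The degree function `deg = - ord_η` on nonzero functions (the value at `0` is `0`). -/
def deg (η : Place K F) (x : F) : ℤ := WithZero.log (η.val x)

/-- A geometric point of `Y = X ∖ {η}`, with values in an algebraic closure of `K`: a closed
point `p ≠ η` and a `K`-algebra homomorphism from its local ring to the algebraic closure
(it kills the maximal ideal, so it is an embedding of the residue field). -/
structure AffinePoint (η : Place K F) where
  place : Place K F
  ne : place ≠ η
  hom : place.ring →ₐ[K] AlgebraicClosure K

/-- Evaluation at a geometric point of `Y` of the functions regular on `Y`. -/
def AffinePoint.eval {η : Place K F} (l : AffinePoint η) :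
    η.regularRing →ₐ[K] AlgebraicClosure K :=
  l.hom.comp (Subalgebra.inclusion (regularRing_le l.ne))

end Place

/-! ### Heights -/

section Heights

variable {K F : Type*} [Field K] [Field F] [Algebra K F]

/-- The Weil height of the point with homogeneous coordinates `x` over the function field `F`:
the sum over all closed points `p` of `deg p * max_i (- ord_p (x i))`. -/
def functionFieldHeight (K : Type*) {F : Type*} [Field K] [Field F] [Algebra K F]
    {ι : Type*} [Fintype ι] (x : ι → F) : ℝ :=
  ∑ᶠ p : Place K F,
    (p.degree : ℝ) * ((WithZero.log (Finset.univ.sup fun i => p.val (x i)) : ℤ) : ℝ)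

theorem numberField_adjoin_range [NumberField K] {ι : Type*} [Finite ι]
    (x : ι → AlgebraicClosure K) :
    NumberField (IntermediateField.adjoin K (Set.range x)) := by
  have : FiniteDimensional K (IntermediateField.adjoin K (Set.range x)) :=
    IntermediateField.finiteDimensional_adjoin fun y _ =>
      Algebra.IsIntegral.isIntegral y
  exact NumberField.of_module_finite K _

/-- The absolute logarithmic Weil height of the point with homogeneous coordinates `x` over the
algebraic closure of the number field `K`. It is computed in the number field `K(x)` and divided
by the degree of that field over `ℚ`. -/
def absLogHeight [NumberField K] {ι : Type*} [Finite ι] (x : ι → AlgebraicClosure K) : ℝ :=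
  haveI : NumberField (IntermediateField.adjoin K (Set.range x)) := numberField_adjoin_range x
  Height.logHeight (fun i =>
      (⟨x i, IntermediateField.subset_adjoin K _ ⟨i, rfl⟩⟩ :
        IntermediateField.adjoin K (Set.range x))) /
    (Module.finrank ℚ (IntermediateField.adjoin K (Set.range x)) : ℝ)

/-- The finite family `s` of functions regular away from `η` consists of global sections of the
line bundle `𝓞(m η)` that generate it: `max_i (- ord_p (s i))` is `0` at every closed point
`p ≠ η` and is `m` at `η`. -/
def GeneratesMultiple (η : Place K F) (m : ℕ) {ι : Type*} [Fintype ι]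
    (s : ι → η.regularRing) : Prop :=
  (∀ p : Place K F, p ≠ η → (Finset.univ.sup fun i => p.val (s i : F)) = 1) ∧
    (Finset.univ.sup fun i => η.val (s i : F)) = WithZero.exp (m : ℤ)

/-- `h` is (the restriction to `Y = X ∖ {η}` of) a Weil height for the divisor class of `η`:
for some `m ≥ 1` and some morphism `s` from `X` to a projective space given by generating sections
of `𝓞(m η)`, the function `h` differs from `(1 / m) * (height of s)` by a bounded function. -/
def IsWeilHeight [NumberField K] (η : Place K F) (h : η.AffinePoint → ℝ) : Prop :=
  ∃ (m r : ℕ) (s : Fin r → η.regularRing), 1 ≤ m ∧ GeneratesMultiple η m s ∧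
    ∃ C : ℝ, ∀ l : η.AffinePoint, |h l - absLogHeight (fun i => l.eval (s i)) / m| ≤ C

end Heights

/-! ### Rational maps of the projective line -/

/-- The degree of the rational map `p / q` (for coprime `p` and `q`). -/
def ratDegree {R : Type*} [CommRing R] (p q : R[X]) : ℕ := max p.natDegree q.natDegree

/-- The rational map `p / q` in homogeneous coordinates:
`[x : y] ↦ [y ^ d * p (x / y) : y ^ d * q (x / y)]` with `d` the degree of `p / q`. -/
def ratLift {R S : Type*} [CommRing R] [CommRing S] [Algebra R S] (p q : R[X])
    (x : Fin 2 → S) : Fin 2 → S :=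
  ![MvPolynomial.aeval x (p.homogenize (ratDegree p q)),
    MvPolynomial.aeval x (q.homogenize (ratDegree p q))]

/-- The point at infinity is a superattracting periodic point of `f = p / q`: for some `n ≥ 1`, the
`n`-th iterate, which in the coordinate `w = 1 / x` is `w ↦ v 1 / v 0`, fixes the point
`w = 0` and has derivative zero there. -/
def SuperattractingAtInfinity {k : Type*} [Field k] (p q : k[X]) : Prop :=
  ∃ n : ℕ, 1 ≤ n ∧
    let v : Fin 2 → k[X] := (ratLift p q)^[n] ![1, X]
    (v 0).eval 0 ≠ 0 ∧ (v 1).eval 0 = 0 ∧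
      (derivative (v 1) * v 0 - v 1 * derivative (v 0)).eval 0 = 0

/-- `H` is the canonical height of the point `x` for the rational map `p / q`, with respect to
the Weil height `ht`: the limit of `ht (f^n (x)) / d ^ n` exists and equals `H`. -/
def HasCanonicalHeight {k : Type*} [Field k] (ht : (Fin 2 → k) → ℝ) (p q : k[X])
    (x : Fin 2 → k) (H : ℝ) : Prop :=
  Tendsto (fun n : ℕ => ht ((ratLift p q)^[n] x) / (ratDegree p q : ℝ) ^ n) atTop (𝓝 H)

/-- `x` is a nonzero constant, i.e. it lies in the image of `Kˣ`. -/
def IsNonzeroConstant (K : Type*) {R : Type*} [Field K] [CommRing R] [Algebra K R] (x : R) :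
    Prop :=
  ∃ t : K, t ≠ 0 ∧ x = algebraMap K R t

end

/-!
The local heights at `λ` are computed with the multiplicative seminorms `g ↦ |g(λ)|` on the ring `A`
of functions regular on `Y`, and the height over `F` with the seminorm `exp (- ord_η)`. All local
estimates hold for an arbitrary multiplicative seminorm `φ` on `A`, with errors of the form
`∑ log max (1, φ c)` over finitely many constants `c` in `K`, chosen independently of `φ`. Summing
over the places of the residue field at `λ` turns such an error into a sum of heights of elements
of `K`, hence into a bound independent of `λ`.

Since the resultant and the leading coefficients are units, `log ‖f x‖ = d log ‖x‖` up to constants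
from `A`. To replace these by constants from `K`, compare with the size `σ` of generating sections
of a multiple of `η`. If `σ` is bounded in terms of constants from `K`, so is every element of `A`.
If it is not, then an iterate of the starting point, whose degree is large, is close to `∞` by a
high power of `σ`. There `f^n`, for `n` such that `f^n` fixes `∞`, multiplies local heights by `d^n`
up to a value at `∞` which is a unit of `A`, hence a constant from `K`, and superattraction absorbs
the coefficients from `A` and keeps the orbit near `∞`. Telescoping gives
`log ‖f^n c‖ / d^n = h log σ + O(1)` in both cases, and `φ = exp (- ord_η)` identifies `h`.
-/

/-! ### Multiplicative seminorms -/

section Seminorm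

variable {R : Type*} [CommRing R] (φ : MulRingSeminorm R)

theorem mulRingSeminorm_natCast_le_of_lt_two_pow {m N : ℕ} (h : m < 2 ^ N) :
    φ m ≤ N * max 1 (φ 2) ^ N := by
  induction N generalizing m with
  | zero => simp [Nat.lt_one_iff.mp h]
  | succ N ih =>
    have hmod : φ ((m % 2 : ℕ) : R) ≤ 1 := by
      rcases Nat.mod_two_eq_zero_or_one m with h | h <;> simp [h]
    have hdiv := ih (m := m / 2) (by omega)
    calc φ m = φ (2 * (m / 2 : ℕ) + (m % 2 : ℕ)) := by
          exact_mod_cast congrArg (fun k : ℕ => φ (k : R)) (Nat.div_add_mod m 2).symm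
      _ ≤ φ 2 * φ (m / 2 : ℕ) + φ (m % 2 : ℕ) := (map_add_le_add φ _ _).trans_eq (by rw [map_mul])
      _ ≤ max 1 (φ 2) * (N * max 1 (φ 2) ^ N) + max 1 (φ 2) ^ (N + 1) := by
          gcongr
          · exact le_max_right _ _
          · exact hmod.trans (one_le_pow₀ (le_max_left _ _))
      _ = (N + 1 : ℕ) * max 1 (φ 2) ^ (N + 1) := by push_cast; ring

theorem le_of_forall_pow_le_mul_pow {u w C : ℝ} {e : ℕ} (hw : 0 ≤ w)
    (h : ∀ N : ℕ, u ^ (N + 1) ≤ C * (N + 1 : ℕ) ^ e * w ^ (N + 1)) : u ≤ w := by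
  by_contra! hlt
  rcases hw.eq_or_lt with rfl | hw
  · simpa [hlt.not_ge] using h 0
  have hlim := ((tendsto_pow_const_div_const_pow_of_one_lt e ((one_lt_div hw).mpr hlt)).const_mul
    C).comp (tendsto_add_atTop_nat 1)
  rw [mul_zero] at hlim
  refine absurd (ge_of_tendsto' hlim fun N => ?_) one_pos.not_ge
  have hu : 0 < (u / w) ^ (N + 1) := pow_pos (div_pos (hw.trans hlt) hw) _
  rw [Function.comp_apply, ← mul_div_assoc, le_div_iff₀ hu, one_mul, div_pow,
    div_le_iff₀ (pow_pos hw _)]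
  exact h N

/- Expanding `φ (x + y) ^ N` by the binomial theorem loses only a factor `φ 2 ^ N` times a
polynomial in `N`, because binomial coefficients have at most `N` binary digits. -/
theorem mulRingSeminorm_add_le (x y : R) : φ (x + y) ≤ max 1 (φ 2) * max (φ x) (φ y) := by
  set B := max 1 (φ 2)
  set m := max (φ x) (φ y)
  have hB : 1 ≤ B := le_max_left _ _
  have hm : 0 ≤ m := (apply_nonneg φ x).trans (le_max_left _ _)
  refine le_of_forall_pow_le_mul_pow (C := 4 * B) (e := 2)
    (mul_nonneg (zero_le_one.trans hB) hm) fun N => ?_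
  have hterm : ∀ i ∈ Finset.range (N + 1 + 1),
      φ (x ^ i * y ^ (N + 1 - i) * (N + 1).choose i) ≤ m ^ (N + 1) * ((N + 2) * B ^ (N + 2)) := by
    intro i hi
    rw [map_mul, map_mul, map_pow, map_pow]
    have hchoose : φ ((N + 1).choose i : R) ≤ (N + 2 : ℕ) * B ^ (N + 2) :=
      mulRingSeminorm_natCast_le_of_lt_two_pow φ
        ((Nat.choose_le_two_pow _ _).trans_lt (Nat.pow_lt_pow_right one_lt_two (by omega)))
    calc φ x ^ i * φ y ^ (N + 1 - i) * φ ((N + 1).choose i : R)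
        ≤ m ^ i * m ^ (N + 1 - i) * ((N + 2 : ℕ) * B ^ (N + 2)) := by
          gcongr
          exacts [le_max_left _ _, le_max_right _ _]
      _ = m ^ (N + 1) * ((N + 2) * B ^ (N + 2)) := by
          rw [← pow_add, Nat.add_sub_cancel' (by simpa [Nat.lt_succ_iff] using hi)]; push_cast; ring
  calc φ (x + y) ^ (N + 1)
      ≤ ∑ _i ∈ Finset.range (N + 1 + 1), m ^ (N + 1) * ((N + 2) * B ^ (N + 2)) := by
        rw [← map_pow, add_pow]
        exact (Finset.le_sum_of_subadditive φ (map_zero φ).le (map_add_le_add φ) _ _).trans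
          (Finset.sum_le_sum hterm)
    _ = (N + 2) ^ 2 * (B * (B * m) ^ (N + 1)) := by
        rw [Finset.sum_const, Finset.card_range, nsmul_eq_mul]; push_cast; ring
    _ ≤ (2 * (N + 1 : ℕ)) ^ 2 * (B * (B * m) ^ (N + 1)) := by
        gcongr; push_cast; linarith
    _ = 4 * B * (N + 1 : ℕ) ^ 2 * (B * m) ^ (N + 1) := by ring

theorem mulRingSeminorm_sum_le {α : Type*} (s : Finset α) {f : α → R} {c : ℝ} (hc : 0 ≤ c)
    (h : ∀ a ∈ s, φ (f a) ≤ c) : φ (∑ a ∈ s, f a) ≤ max 1 (φ 2) ^ s.card * c := by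
  classical
  induction s using Finset.induction_on with
  | empty => simpa using hc
  | insert a s ha ih =>
    have hB : 1 ≤ max 1 (φ 2) := le_max_left _ _
    rw [Finset.sum_insert ha, Finset.card_insert_of_notMem ha, pow_succ', mul_assoc]
    refine (mulRingSeminorm_add_le φ _ _).trans ?_
    gcongr
    refine max_le ((h a (Finset.mem_insert_self a s)).trans ?_)
      (ih fun b hb => h b (Finset.mem_insert_of_mem hb))
    exact le_mul_of_one_le_left hc (one_le_pow₀ hB)

end Seminorm

section Domination

variable {k R : Type*} [CommRing k] [CommRing R] [Algebra k R]

/-- The product of `max 1 (φ c)` over the constants `c` in `κ`. Its logarithm, summed over the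
places of a number field, is a sum of heights of constants; this is how a bound which depends on a
seminorm `φ` only through `constBound κ φ` becomes a uniform bound for heights. -/
def constBound (κ : Multiset k) (φ : MulRingSeminorm R) : ℝ :=
  (κ.map fun c => max 1 (φ (algebraMap k R c))).prod

theorem constBound_zero (φ : MulRingSeminorm R) : constBound (0 : Multiset k) φ = 1 := rfl

theorem constBound_singleton (c : k) (φ : MulRingSeminorm R) :
    constBound {c} φ = max 1 (φ (algebraMap k R c)) := by simp [constBound]

theorem constBound_add (κ κ' : Multiset k) (φ : MulRingSeminorm R) :
    constBound (κ + κ') φ = constBound κ φ * constBound κ' φ := by simp [constBound]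

theorem constBound_nsmul (n : ℕ) (κ : Multiset k) (φ : MulRingSeminorm R) :
    constBound (n • κ) φ = constBound κ φ ^ n := by
  simp [constBound, Multiset.map_nsmul, Multiset.prod_nsmul]

theorem one_le_constBound (κ : Multiset k) (φ : MulRingSeminorm R) : 1 ≤ constBound κ φ :=
  Multiset.one_le_prod fun _ hx => by
    obtain ⟨c, -, rfl⟩ := Multiset.mem_map.mp hx
    exact le_max_left _ _

theorem constBound_pos (κ : Multiset k) (φ : MulRingSeminorm R) : 0 < constBound κ φ :=
  one_pos.trans_le (one_le_constBound κ φ)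

theorem constBound_mono {κ κ' : Multiset k} (h : κ ≤ κ') (φ : MulRingSeminorm R) :
    constBound κ φ ≤ constBound κ' φ := by
  obtain ⟨κ'', rfl⟩ := Multiset.le_iff_exists_add.mp h
  rw [constBound_add]
  exact le_mul_of_one_le_right (constBound_pos _ _).le (one_le_constBound _ _)

theorem le_constBound {κ : Multiset k} (φ : MulRingSeminorm R) {c : k} (hc : c ∈ κ) :
    φ (algebraMap k R c) ≤ constBound κ φ :=
  (le_max_right _ _).trans ((constBound_singleton c φ).symm.trans_le
    (constBound_mono (Multiset.singleton_le.mpr hc) φ))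

variable {I : Type*}

/-- `f ≤ g` up to a factor `constBound κ` with `κ` independent of the index of the family of
seminorms `φ`. -/
def DominatedBy (k : Type*) {R I : Type*} [CommRing k] [CommRing R] [Algebra k R]
    (φ : I → MulRingSeminorm R) (f g : I → ℝ) : Prop :=
  ∃ κ : Multiset k, ∀ i, f i ≤ constBound κ (φ i) * g i

namespace DominatedBy

variable {φ : I → MulRingSeminorm R} {f f' g g' h : I → ℝ}

theorem of_le (hfg : ∀ i, f i ≤ g i) : DominatedBy k φ f g :=
  ⟨0, fun i => by simpa [constBound_zero] using hfg i⟩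

protected theorem trans (hfg : DominatedBy k φ f g) (hgh : DominatedBy k φ g h) :
    DominatedBy k φ f h := by
  obtain ⟨κ, hκ⟩ := hfg
  obtain ⟨κ', hκ'⟩ := hgh
  refine ⟨κ + κ', fun i => (hκ i).trans ?_⟩
  rw [constBound_add, mul_assoc]
  exact mul_le_mul_of_nonneg_left (hκ' i) (constBound_pos _ _).le

theorem trans_le (hfg : DominatedBy k φ f g) (hgh : ∀ i, g i ≤ h i) : DominatedBy k φ f h :=
  hfg.trans (of_le hgh)

protected theorem mul (hf : ∀ i, 0 ≤ f i) (hf' : ∀ i, 0 ≤ f' i) (hfg : DominatedBy k φ f g)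
    (hfg' : DominatedBy k φ f' g') :
    DominatedBy k φ (fun i => f i * f' i) fun i => g i * g' i := by
  obtain ⟨κ, hκ⟩ := hfg
  obtain ⟨κ', hκ'⟩ := hfg'
  refine ⟨κ + κ', fun i => ?_⟩
  rw [constBound_add, mul_mul_mul_comm]
  exact mul_le_mul (hκ i) (hκ' i) (hf' i) ((hf i).trans (hκ i))

protected theorem pow (hf : ∀ i, 0 ≤ f i) (hfg : DominatedBy k φ f g) (n : ℕ) :
    DominatedBy k φ (fun i => f i ^ n) fun i => g i ^ n := by
  obtain ⟨κ, hκ⟩ := hfg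
  refine ⟨n • κ, fun i => ?_⟩
  rw [constBound_nsmul, ← mul_pow]
  exact pow_le_pow_left₀ (hf i) (hκ i) n

theorem of_pow {n : ℕ} (hn : n ≠ 0) (hg : ∀ i, 0 ≤ g i)
    (hfg : DominatedBy k φ (fun i => f i ^ n) fun i => g i ^ n) : DominatedBy k φ f g := by
  obtain ⟨κ, hκ⟩ := hfg
  refine ⟨κ, fun i => le_of_pow_le_pow_left₀ hn
    (mul_nonneg (constBound_pos _ _).le (hg i)) ((hκ i).trans ?_)⟩
  rw [mul_pow]
  exact mul_le_mul_of_nonneg_right (le_self_pow₀ (one_le_constBound _ _) hn)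
    (pow_nonneg (hg i) n)

protected theorem max (hg : ∀ i, 0 ≤ g i) (hf : DominatedBy k φ f g) (hf' : DominatedBy k φ f' g) :
    DominatedBy k φ (fun i => max (f i) (f' i)) g := by
  obtain ⟨κ, hκ⟩ := hf
  obtain ⟨κ', hκ'⟩ := hf'
  exact ⟨κ + κ', fun i => max_le
    ((hκ i).trans (mul_le_mul_of_nonneg_right (constBound_mono (by simp) _) (hg i)))
    ((hκ' i).trans (mul_le_mul_of_nonneg_right (constBound_mono (by simp) _) (hg i)))⟩

theorem of_cases (S : Set I) (hg : ∀ i, 0 ≤ g i)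
    (hS : DominatedBy k (fun i : S => φ i) (fun i => f i) fun i => g i)
    (hSc : DominatedBy k (fun i : ↥Sᶜ => φ i) (fun i => f i) fun i => g i) :
    DominatedBy k φ f g := by
  obtain ⟨κ, hκ⟩ := hS
  obtain ⟨κ', hκ'⟩ := hSc
  refine ⟨κ + κ', fun i => ?_⟩
  by_cases hi : i ∈ S
  · exact (hκ ⟨i, hi⟩).trans (mul_le_mul_of_nonneg_right (constBound_mono (by simp) _) (hg i))
  · exact (hκ' ⟨i, hi⟩).trans (mul_le_mul_of_nonneg_right (constBound_mono (by simp) _) (hg i))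

protected theorem comp {J : Type*} (e : J → I) (hfg : DominatedBy k φ f g) :
    DominatedBy k (fun j => φ (e j)) (fun j => f (e j)) fun j => g (e j) :=
  hfg.imp fun _ hκ j => hκ (e j)

protected theorem const (c : k) : DominatedBy k φ (fun i => φ i (algebraMap k R c)) fun _ => 1 :=
  ⟨{c}, fun i => by rw [constBound_singleton, mul_one]; exact le_max_right _ _⟩

protected theorem sum {α : Type*} (s : Finset α) {x : I → α → R} (hg : ∀ i, 0 ≤ g i)
    (hx : ∀ a ∈ s, DominatedBy k φ (fun i => φ i (x i a)) g) :
    DominatedBy k φ (fun i => φ i (∑ a ∈ s, x i a)) g := by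
  choose! κ hκ using hx
  refine ⟨s.card • {2} + ∑ a ∈ s, κ a, fun i => ?_⟩
  rw [constBound_add, constBound_nsmul, constBound_singleton, map_ofNat, mul_assoc]
  refine mulRingSeminorm_sum_le _ s (mul_nonneg (constBound_pos _ _).le (hg i)) fun a ha =>
    (hκ a ha i).trans (mul_le_mul_of_nonneg_right (constBound_mono ?_ _) (hg i))
  exact Finset.single_le_sum_of_canonicallyOrdered ha

protected theorem add {x y : I → R} (hg : ∀ i, 0 ≤ g i)
    (hx : DominatedBy k φ (fun i => φ i (x i)) g)
    (hy : DominatedBy k φ (fun i => φ i (y i)) g) :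
    DominatedBy k φ (fun i => φ i (x i + y i)) g := by
  simpa using DominatedBy.sum (x := fun i => ![x i, y i]) Finset.univ hg (by simpa using ⟨hx, hy⟩)

end DominatedBy

end Domination

section Telescoping

variable {u : ℕ → ℝ} {q C : ℝ}

theorem abs_div_pow_succ_sub_le (hq : 0 < q) {j : ℕ} (h : |u (j + 1) - q * u j| ≤ C) :
    |u (j + 1) / q ^ (j + 1) - u j / q ^ j| ≤ C / q ^ (j + 1) := by
  have hqj : 0 < q ^ (j + 1) := pow_pos hq _
  have heq : u (j + 1) / q ^ (j + 1) - u j / q ^ j = (u (j + 1) - q * u j) / q ^ (j + 1) := by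
    field_simp
    ring
  rw [heq, abs_div, abs_of_pos hqj]
  exact div_le_div_of_nonneg_right h hqj.le

theorem abs_div_pow_sub_le (hq : 2 ≤ q) (h : ∀ j, |u (j + 1) - q * u j| ≤ C) (j : ℕ) :
    |u j / q ^ j - u 0| ≤ C := by
  have hq0 : 0 < q := two_pos.trans_le hq
  have hC : 0 ≤ C := (abs_nonneg _).trans (h 0)
  suffices |u j / q ^ j - u 0| ≤ C - C / q ^ j from
    this.trans (sub_le_self _ (div_nonneg hC (pow_nonneg hq0.le j)))
  induction j with
  | zero => simp
  | succ j ih =>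
    have hhalf : 2 * (C / q ^ (j + 1)) ≤ C / q ^ j := by
      rw [pow_succ', ← div_div, ← mul_div_assoc, ← mul_div_assoc, mul_comm, mul_div_assoc]
      gcongr
      exact mul_le_of_le_one_right hC ((div_le_one hq0).mpr hq)
    linarith [abs_sub_le (u (j + 1) / q ^ (j + 1)) (u j / q ^ j) (u 0),
      abs_div_pow_succ_sub_le hq0 (h j)]

theorem exists_tendsto_div_pow (hq : 2 ≤ q) (h : ∀ j, |u (j + 1) - q * u j| ≤ C) :
    ∃ H, Tendsto (fun j => u j / q ^ j) atTop (𝓝 H) := by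
  have hq0 : 0 < q := two_pos.trans_le hq
  refine cauchySeq_tendsto_of_complete (cauchySeq_of_le_geometric (1 / q) (C / q)
    ((div_lt_one hq0).mpr (one_lt_two.trans_le hq)) fun j => ?_)
  rw [dist_comm, Real.dist_eq]
  rw [one_div_pow, div_mul_div_comm, mul_one, ← pow_succ']
  exact abs_div_pow_succ_sub_le hq0 (h j)

end Telescoping

section LogBounded

variable {k R I : Type*} [CommRing k] [CommRing R] [Algebra k R] {φ : I → MulRingSeminorm R}

/-- `|A i| ≤ log (constBound κ)` with `κ` independent of the index: the additive counterpart of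
`DominatedBy`. -/
def LogBounded (k : Type*) {R I : Type*} [CommRing k] [CommRing R] [Algebra k R]
    (φ : I → MulRingSeminorm R) (A : I → ℝ) : Prop :=
  ∃ κ : Multiset k, ∀ i, |A i| ≤ Real.log (constBound κ (φ i))

theorem log_constBound_mono {κ κ' : Multiset k} (h : κ ≤ κ') (φ : MulRingSeminorm R) :
    Real.log (constBound κ φ) ≤ Real.log (constBound κ' φ) :=
  Real.log_le_log (constBound_pos _ _) (constBound_mono h φ)

theorem abs_log_sub_log_le {u v c : ℝ} (hu : 0 < u) (hv : 0 < v) (huv : u ≤ c * v)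
    (hvu : v ≤ c * u) : |Real.log u - Real.log v| ≤ Real.log c := by
  have hc : 0 < c := pos_of_mul_pos_left (hu.trans_le huv) hv.le
  rw [abs_sub_le_iff, sub_le_iff_le_add, sub_le_iff_le_add, ← Real.log_mul hc.ne' hv.ne',
    ← Real.log_mul hc.ne' hu.ne']
  exact ⟨Real.log_le_log hu huv, Real.log_le_log hv hvu⟩

theorem DominatedBy.logBounded {f g : I → ℝ} (hf : ∀ i, 0 < f i) (hg : ∀ i, 0 < g i)
    (hfg : DominatedBy k φ f g) (hgf : DominatedBy k φ g f) :
    LogBounded k φ fun i => Real.log (f i) - Real.log (g i) := by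
  obtain ⟨κ, hκ⟩ := hfg
  obtain ⟨κ', hκ'⟩ := hgf
  exact ⟨κ + κ', fun i => abs_log_sub_log_le (hf i) (hg i)
    ((hκ i).trans (mul_le_mul_of_nonneg_right (constBound_mono (by simp) _) (hg i).le))
    ((hκ' i).trans (mul_le_mul_of_nonneg_right (constBound_mono (by simp) _) (hf i).le))⟩

namespace LogBounded

variable {A B : I → ℝ}

protected theorem comp {J : Type*} (hA : LogBounded k φ A) (e : J → I) :
    LogBounded k (fun j => φ (e j)) fun j => A (e j) :=
  hA.imp fun _ hκ j => hκ (e j)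

protected theorem add (hA : LogBounded k φ A) (hB : LogBounded k φ B) :
    LogBounded k φ fun i => A i + B i := by
  obtain ⟨κ, hκ⟩ := hA
  obtain ⟨κ', hκ'⟩ := hB
  refine ⟨κ + κ', fun i => (abs_add_le _ _).trans ?_⟩
  rw [constBound_add, Real.log_mul (constBound_pos _ _).ne' (constBound_pos _ _).ne']
  exact add_le_add (hκ i) (hκ' i)

theorem bdd_mul {q : I → ℝ} {C : ℝ} (hA : LogBounded k φ A) (hq : ∀ i, |q i| ≤ C) :
    LogBounded k φ fun i => q i * A i := by
  obtain ⟨κ, hκ⟩ := hA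
  obtain ⟨n, hn⟩ := exists_nat_ge C
  refine ⟨n • κ, fun i => ?_⟩
  rw [abs_mul, constBound_nsmul, Real.log_pow]
  exact mul_le_mul ((hq i).trans hn) (hκ i) (abs_nonneg _) n.cast_nonneg

theorem of_cases (S : Set I) (hS : LogBounded k (fun i : S => φ i) fun i => A i)
    (hSc : LogBounded k (fun i : ↥Sᶜ => φ i) fun i => A i) : LogBounded k φ A := by
  obtain ⟨κ, hκ⟩ := hS
  obtain ⟨κ', hκ'⟩ := hSc
  refine ⟨κ + κ', fun i => ?_⟩
  by_cases hi : i ∈ S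
  · exact (hκ ⟨i, hi⟩).trans (log_constBound_mono (Multiset.le_add_right _ _) _)
  · exact (hκ' ⟨i, hi⟩).trans (log_constBound_mono (Multiset.le_add_left _ _) _)

theorem div_pow_sub {u : I → ℕ → ℝ} {q : ℝ} (hq : 2 ≤ q)
    (h : LogBounded k (fun s : I × ℕ => φ s.1) fun s => u s.1 (s.2 + 1) - q * u s.1 s.2) :
    LogBounded k (fun s : I × ℕ => φ s.1) fun s => u s.1 s.2 / q ^ s.2 - u s.1 0 :=
  h.imp fun _ hκ s => abs_div_pow_sub_le hq (fun j => hκ (s.1, j)) s.2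

end LogBounded

end LogBounded

section SupNorm

variable {R ι : Type*} [CommRing R]

/-- The largest value of the seminorm `φ` on the entries of `x`, that is, the local factor at `φ` of
the height of the point with homogeneous coordinates `x`; it is `0` for empty `x`. -/
noncomputable def supSeminorm (φ : MulRingSeminorm R) (x : ι → R) : ℝ :=
  ⨆ i, φ (x i)

variable (φ : MulRingSeminorm R) (x : ι → R)

theorem le_supSeminorm [Finite ι] (i : ι) : φ (x i) ≤ supSeminorm φ x :=
  le_ciSup (f := fun i => φ (x i)) (Set.finite_range _).bddAbove i

theorem supSeminorm_nonneg : 0 ≤ supSeminorm φ x :=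
  Real.iSup_nonneg fun _ => apply_nonneg φ _

variable {φ x}

theorem supSeminorm_le {c : ℝ} (hc : 0 ≤ c) (h : ∀ i, φ (x i) ≤ c) : supSeminorm φ x ≤ c :=
  Real.iSup_le h hc

theorem supSeminorm_pos_of_isCoprime {x : Fin 2 → R} (h : IsCoprime (x 0) (x 1)) :
    0 < supSeminorm φ x := by
  refine (supSeminorm_nonneg φ x).lt_of_ne' fun h0 => ?_
  obtain ⟨u, w, huw⟩ := h
  have hzero : ∀ i, φ (x i) = 0 := fun i =>
    le_antisymm ((le_supSeminorm φ x i).trans h0.le) (apply_nonneg φ _)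
  have hle := map_add_le_add φ (u * x 0) (w * x 1)
  rw [huw, map_one, map_mul, map_mul, hzero, hzero] at hle
  norm_num at hle

theorem supSeminorm_pow [Finite ι] [Nonempty ι] (n : ℕ) :
    supSeminorm φ (x ^ n) = supSeminorm φ x ^ n := by
  obtain ⟨i, hi⟩ := exists_eq_ciSup_of_finite (f := fun i => φ (x i))
  refine le_antisymm (supSeminorm_le (pow_nonneg (supSeminorm_nonneg φ x) n) fun j => ?_) ?_
  · rw [Pi.pow_apply, map_pow]
    exact pow_le_pow_left₀ (apply_nonneg φ _) (le_supSeminorm φ x j) n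
  · rw [supSeminorm, ← hi, ← map_pow]
    exact le_supSeminorm φ (x ^ n) i

end SupNorm

section Forms

variable {k R I ι : Type*} [CommRing k] [CommRing R] [Algebra k R] {φ : I → MulRingSeminorm R}

theorem DominatedBy.supSeminorm [Finite ι] {x : I → ι → R} {g : I → ℝ} (hg : ∀ i, 0 ≤ g i)
    (hx : ∀ a, DominatedBy k φ (fun i => φ i (x i a)) g) :
    DominatedBy k φ (fun i => supSeminorm (φ i) (x i)) g := by
  cases nonempty_fintype ι
  choose κ hκ using hx
  exact ⟨∑ a, κ a, fun i => supSeminorm_le (mul_nonneg (constBound_pos _ _).le (hg i)) fun a =>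
    (hκ a i).trans (mul_le_mul_of_nonneg_right (constBound_mono
      (Finset.single_le_sum_of_canonicallyOrdered (Finset.mem_univ a)) _) (hg i))⟩

theorem dominatedBy_aeval_of_isHomogeneous [Finite ι] {G : MvPolynomial ι k} {N : ℕ}
    (hG : G.IsHomogeneous N) (x : I → ι → R) :
    DominatedBy k φ (fun i => φ i (MvPolynomial.aeval (x i) G))
      fun i => supSeminorm (φ i) (x i) ^ N := by
  cases nonempty_fintype ι
  have hsup : ∀ i, 0 ≤ supSeminorm (φ i) (x i) ^ N := fun i => pow_nonneg (supSeminorm_nonneg _ _) N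
  simp only [MvPolynomial.aeval_def, MvPolynomial.eval₂_eq']
  refine DominatedBy.sum _ hsup fun e he => ?_
  have hmonomial : ∀ i, φ i (∏ a, x i a ^ e a) ≤ supSeminorm (φ i) (x i) ^ N := fun i => by
    rw [map_prod, hG.degree_eq_sum_deg_support he,
      Finset.sum_subset (Finset.subset_univ e.support) fun a _ => Finsupp.notMem_support_iff.mp,
      ← Finset.prod_pow_eq_pow_sum]
    refine Finset.prod_le_prod (fun a _ => apply_nonneg _ _) fun a _ => ?_
    rw [map_pow]
    exact pow_le_pow_left₀ (apply_nonneg _ _) (le_supSeminorm _ _ a) _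
  simpa only [map_mul, one_mul] using DominatedBy.mul (fun i => apply_nonneg _ _)
    (fun i => apply_nonneg _ _) (DominatedBy.const (φ := φ) (G.coeff e))
    (DominatedBy.of_le hmonomial)

attribute [local instance] MvPolynomial.gradedAlgebra in
theorem exists_isHomogeneous_mul_add_mul_eq {P Q f : MvPolynomial ι R} {d N : ℕ}
    (hP : P.IsHomogeneous d) (hQ : Q.IsHomogeneous d) (hf : f.IsHomogeneous N) (hdN : d ≤ N)
    (h : f ∈ Ideal.span {P, Q}) :
    ∃ A B : MvPolynomial ι R, A.IsHomogeneous (N - d) ∧ B.IsHomogeneous (N - d) ∧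
      A * P + B * Q = f := by
  obtain ⟨A, B, rfl⟩ := Ideal.mem_span_pair.mp h
  refine ⟨_, _, MvPolynomial.homogeneousComponent_isHomogeneous (N - d) A,
    MvPolynomial.homogeneousComponent_isHomogeneous (N - d) B, ?_⟩
  have hmul : ∀ {S : MvPolynomial ι R} (_ : S.IsHomogeneous d) (T : MvPolynomial ι R),
      MvPolynomial.homogeneousComponent N (T * S) =
        MvPolynomial.homogeneousComponent (N - d) T * S := fun {S} hS T => by
    simp only [← MvPolynomial.decomposition.decompose'_apply]
    exact DirectSum.coe_decompose_mul_of_right_mem_of_le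
      (𝒜 := MvPolynomial.homogeneousSubmodule ι R) (a := T) (b := S) hS hdN
  rw [← hmul hP, ← hmul hQ, ← map_add, MvPolynomial.homogeneousComponent_of_mem hf, if_pos rfl]

end Forms

/-! ### Rational maps and the superattracting basin -/

section RationalMap

variable {R : Type*} [CommRing R] {P Q : R[X]}

theorem homogenize_eq_C_mul_X_pow_add (p : R[X]) {d : ℕ} (hd : p.natDegree ≤ d + 1) :
    p.homogenize (d + 1) = MvPolynomial.C (p.coeff (d + 1)) * MvPolynomial.X 0 ^ (d + 1) +
      MvPolynomial.X 1 * (p.erase (d + 1)).homogenize d := by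
  have herase : (p.erase (d + 1)).natDegree ≤ d := natDegree_le_iff_coeff_eq_zero.mpr fun n hn => by
    rw [coeff_erase]
    split_ifs with h
    · rfl
    · exact coeff_eq_zero_of_natDegree_lt (by omega)
  have hhom : (p.erase (d + 1)).homogenize (1 + d) =
      MvPolynomial.X 1 * (p.erase (d + 1)).homogenize d := by
    simpa using homogenize_mul (1 : R[X]) _ (natDegree_one.trans_le zero_le_one) herase
  conv_lhs => rw [← monomial_add_erase p (d + 1), homogenize_add, ← C_mul_X_pow_eq_monomial,
    homogenize_C_mul, homogenize_X_pow le_rfl]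
  rw [Nat.sub_self, pow_zero, mul_one, ← hhom, add_comm 1 d]

theorem X_one_mem_radical_span_homogenize (hd : 1 ≤ ratDegree P Q) (hres : IsUnit (resultant P Q)) :
    MvPolynomial.X 1 ∈ (Ideal.span {P.homogenize (ratDegree P Q),
      Q.homogenize (ratDegree P Q)}).radical := by
  set d := ratDegree P Q with hd_def
  obtain ⟨U, V, -, -, hUV⟩ := exists_mul_add_mul_eq_C_resultant P Q le_rfl le_rfl
    (by rw [ratDegree] at hd_def; omega)
  obtain ⟨c, hc⟩ := hres.exists_left_inv
  set e := max U.natDegree V.natDegree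
  have hhom : P.homogenize d * U.homogenize e + Q.homogenize d * V.homogenize e =
      MvPolynomial.C (resultant P Q) * MvPolynomial.X 1 ^ (d + e) := by
    rw [← homogenize_C, ← hUV, homogenize_add,
      homogenize_mul P U (m := d) (n := e) (le_max_left _ _) (le_max_left _ _),
      homogenize_mul Q V (m := d) (n := e) (le_max_right _ _) (le_max_right _ _)]
  refine ⟨d + e, Ideal.mem_span_pair.mpr
    ⟨MvPolynomial.C c * U.homogenize e, MvPolynomial.C c * V.homogenize e, ?_⟩⟩
  calc _ = MvPolynomial.C c *
        (P.homogenize d * U.homogenize e + Q.homogenize d * V.homogenize e) := by ring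
    _ = _ := by rw [hhom, ← mul_assoc, ← MvPolynomial.C_mul, hc, MvPolynomial.C_1, one_mul]

theorem X_zero_mem_radical_of_isUnit_leadingCoeff {J : Ideal (MvPolynomial (Fin 2) R)} {p : R[X]}
    (hd : p.natDegree ≠ 0) (hp : IsUnit p.leadingCoeff)
    (hJ : p.homogenize p.natDegree ∈ J.radical) (hX : MvPolynomial.X 1 ∈ J.radical) :
    MvPolynomial.X 0 ∈ J.radical := by
  obtain ⟨d, hd⟩ := Nat.exists_eq_add_one_of_ne_zero hd
  rw [hd, homogenize_eq_C_mul_X_pow_add p hd.le, J.radical.add_mem_iff_left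
    (J.radical.mul_mem_right _ hX), ← hd, coeff_natDegree,
    J.radical.unit_mul_mem_iff_mem (hp.map MvPolynomial.C)] at hJ
  exact Ideal.mem_radical_of_pow_mem hJ

theorem X_mem_radical_span_homogenize (hd : 1 ≤ ratDegree P Q) (hres : IsUnit (resultant P Q))
    (hP : IsUnit P.leadingCoeff) (hQ : IsUnit Q.leadingCoeff) (i : Fin 2) :
    MvPolynomial.X i ∈ (Ideal.span {P.homogenize (ratDegree P Q),
      Q.homogenize (ratDegree P Q)}).radical := by
  have hX := X_one_mem_radical_span_homogenize hd hres
  fin_cases i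
  · rcases max_choice P.natDegree Q.natDegree with h | h
    · rw [ratDegree, h] at hd hX ⊢
      exact X_zero_mem_radical_of_isUnit_leadingCoeff (by omega) hP
        (Ideal.le_radical (Ideal.subset_span (by simp))) hX
    · rw [ratDegree, h] at hd hX ⊢
      exact X_zero_mem_radical_of_isUnit_leadingCoeff (by omega) hQ
        (Ideal.le_radical (Ideal.subset_span (by simp))) hX
  · exact hX

theorem exists_isHomogeneous_mul_homogenize_eq_X_pow (hd : 1 ≤ ratDegree P Q)
    (hres : IsUnit (resultant P Q)) (hP : IsUnit P.leadingCoeff) (hQ : IsUnit Q.leadingCoeff) :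
    ∃ M : ℕ, ∀ i, ∃ A B : MvPolynomial (Fin 2) R, A.IsHomogeneous M ∧ B.IsHomogeneous M ∧
      A * P.homogenize (ratDegree P Q) + B * Q.homogenize (ratDegree P Q) =
        MvPolynomial.X i ^ (M + ratDegree P Q) := by
  choose N hN using X_mem_radical_span_homogenize hd hres hP hQ
  refine ⟨N 0 + N 1, fun i => ?_⟩
  have hNM : N i ≤ N 0 + N 1 + ratDegree P Q := by fin_cases i <;> simp <;> omega
  simpa only [Nat.add_sub_cancel] using exists_isHomogeneous_mul_add_mul_eq
    (isHomogeneous_homogenize P) (isHomogeneous_homogenize Q)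
    (MvPolynomial.isHomogeneous_X_pow i _) (Nat.le_add_left _ _)
    (Ideal.pow_mem_of_pow_mem _ (hN i) hNM)

variable {S : Type*} [CommRing S] [Algebra R S]

theorem isCoprime_ratLift (hd : 1 ≤ ratDegree P Q) (hres : IsUnit (resultant P Q))
    (hP : IsUnit P.leadingCoeff) (hQ : IsUnit Q.leadingCoeff) {x : Fin 2 → S}
    (hx : IsCoprime (x 0) (x 1)) : IsCoprime (ratLift P Q x 0) (ratLift P Q x 1) := by
  have hmem : ∀ i, x i ∈ (Ideal.span {ratLift P Q x 0, ratLift P Q x 1}).radical := fun i => by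
    obtain ⟨N, hN⟩ := X_mem_radical_span_homogenize hd hres hP hQ i
    obtain ⟨A, B, hAB⟩ := Ideal.mem_span_pair.mp hN
    exact ⟨N, Ideal.mem_span_pair.mpr ⟨MvPolynomial.aeval x A, MvPolynomial.aeval x B,
      by simpa [ratLift] using congrArg (MvPolynomial.aeval x) hAB⟩⟩
  obtain ⟨u, w, huw⟩ := hx
  have hone := Ideal.add_mem _ (Ideal.mul_mem_left _ u (hmem 0)) (Ideal.mul_mem_left _ w (hmem 1))
  rw [huw, ← Ideal.eq_top_iff_one, Ideal.radical_eq_top, Ideal.eq_top_iff_one] at hone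
  exact Ideal.mem_span_pair.mp hone

theorem isCoprime_ratLift_iterate (hd : 1 ≤ ratDegree P Q) (hres : IsUnit (resultant P Q))
    (hP : IsUnit P.leadingCoeff) (hQ : IsUnit Q.leadingCoeff) {x : Fin 2 → S}
    (hx : IsCoprime (x 0) (x 1)) (n : ℕ) :
    IsCoprime ((ratLift P Q)^[n] x 0) ((ratLift P Q)^[n] x 1) := by
  induction n with
  | zero => exact hx
  | succ n ih =>
    rw [Function.iterate_succ_apply']
    exact isCoprime_ratLift hd hres hP hQ ih

variable {I : Type*} {φ : I → MulRingSeminorm S}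

theorem dominatedBy_supSeminorm_ratLift (P Q : R[X]) (x : I → Fin 2 → S) :
    DominatedBy R φ (fun i => supSeminorm (φ i) (ratLift P Q (x i)))
      fun i => supSeminorm (φ i) (x i) ^ ratDegree P Q := by
  refine DominatedBy.supSeminorm (fun i => pow_nonneg (supSeminorm_nonneg _ _) _) fun a => ?_
  fin_cases a
  · exact dominatedBy_aeval_of_isHomogeneous (isHomogeneous_homogenize P) x
  · exact dominatedBy_aeval_of_isHomogeneous (isHomogeneous_homogenize Q) x

theorem supSeminorm_pow_dominatedBy_ratLift (hd : 1 ≤ ratDegree P Q) (hres : IsUnit (resultant P Q))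
    (hP : IsUnit P.leadingCoeff) (hQ : IsUnit Q.leadingCoeff) (x : I → Fin 2 → S) :
    DominatedBy R φ (fun i => supSeminorm (φ i) (x i) ^ ratDegree P Q)
      fun i => supSeminorm (φ i) (ratLift P Q (x i)) := by
  set d := ratDegree P Q
  obtain ⟨M, hM⟩ := exists_isHomogeneous_mul_homogenize_eq_X_pow hd hres hP hQ
  have hentry : ∀ a, DominatedBy R φ (fun i => φ i ((x i ^ (M + d)) a))
      fun i => supSeminorm (φ i) (x i) ^ M * supSeminorm (φ i) (ratLift P Q (x i)) := fun a => by
    obtain ⟨A, B, hA, hB, hAB⟩ := hM a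
    have heval : ∀ i, (x i ^ (M + d)) a = MvPolynomial.aeval (x i) A * ratLift P Q (x i) 0 +
        MvPolynomial.aeval (x i) B * ratLift P Q (x i) 1 := fun i => by
      simpa [ratLift] using congrArg (MvPolynomial.aeval (x i)) hAB.symm
    have hterm : ∀ {T : MvPolynomial (Fin 2) R} (_ : T.IsHomogeneous M) (b : Fin 2),
        DominatedBy R φ (fun i => φ i (MvPolynomial.aeval (x i) T * ratLift P Q (x i) b))
          fun i => supSeminorm (φ i) (x i) ^ M * supSeminorm (φ i) (ratLift P Q (x i)) :=
        fun hT b => by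
      simp only [map_mul]
      exact DominatedBy.mul (fun _ => apply_nonneg _ _) (fun _ => apply_nonneg _ _)
        (dominatedBy_aeval_of_isHomogeneous hT x)
        (DominatedBy.of_le fun i => le_supSeminorm _ _ b)
    simp only [heval]
    exact DominatedBy.add (fun i => mul_nonneg (pow_nonneg (supSeminorm_nonneg _ _) _)
      (supSeminorm_nonneg _ _)) (hterm hA 0) (hterm hB 1)
  obtain ⟨κ, hκ⟩ := DominatedBy.supSeminorm
    (fun i => mul_nonneg (pow_nonneg (supSeminorm_nonneg _ _) _) (supSeminorm_nonneg _ _)) hentry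
  refine ⟨κ, fun i => ?_⟩
  rcases (supSeminorm_nonneg (φ i) (x i)).eq_or_lt with h0 | hpos
  · beta_reduce
    rw [← h0, zero_pow (by omega)]
    exact mul_nonneg (constBound_pos _ _).le (supSeminorm_nonneg _ _)
  · refine le_of_mul_le_mul_left ?_ (pow_pos hpos M)
    simpa only [supSeminorm_pow, pow_add (supSeminorm _ _), mul_left_comm] using hκ i

end RationalMap

section Iterates

variable {R S R' S' : Type*} [CommRing R] [CommRing S] [CommRing R'] [CommRing S']
  [Algebra R S] [Algebra R' S'] {p q : R[X]}

theorem ratDegree_map [Nontrivial R'] (f : R →+* R') (hp : IsUnit p.leadingCoeff)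
    (hq : IsUnit q.leadingCoeff) : ratDegree (p.map f) (q.map f) = ratDegree p q := by
  rw [ratDegree, ratDegree, natDegree_map_eq_of_isUnit_leadingCoeff f hp,
    natDegree_map_eq_of_isUnit_leadingCoeff f hq]

theorem ratLift_semiconj (f : R →+* R') (g : S →+* S')
    (hfg : g.comp (algebraMap R S) = (algebraMap R' S').comp f)
    (hd : ratDegree (p.map f) (q.map f) = ratDegree p q) :
    Function.Semiconj (fun (x : Fin 2 → S) => g ∘ x) (ratLift p q)
      (ratLift (p.map f) (q.map f)) := by
  intro x
  have haeval : ∀ G : MvPolynomial (Fin 2) R,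
      g (MvPolynomial.aeval x G) = MvPolynomial.aeval (g ∘ x) (G.map f) := fun G => by
    rw [MvPolynomial.aeval_def, MvPolynomial.aeval_def, MvPolynomial.eval₂_map,
      MvPolynomial.eval₂_comp_left, hfg]
  funext i
  fin_cases i <;> simp [ratLift, hd, haeval, homogenize_map]

theorem ratLift_map_iterate [Nontrivial R'] (f : R →+* R') (hp : IsUnit p.leadingCoeff)
    (hq : IsUnit q.leadingCoeff) (x : Fin 2 → R) (n : ℕ) :
    (ratLift (p.map f) (q.map f))^[n] (f ∘ x) = f ∘ (ratLift p q)^[n] x :=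
  ((ratLift_semiconj f f rfl (ratDegree_map f hp hq)).iterate_right n x).symm

variable (p q)

theorem aeval_ratLift_iterate_X (x : Fin 2 → S) (n : ℕ) (i : Fin 2) :
    MvPolynomial.aeval x ((ratLift p q)^[n] (MvPolynomial.X (R := R)) i) =
      (ratLift p q)^[n] x i := by
  have hconj := ratLift_semiconj (p := p) (q := q) (RingHom.id R)
    (MvPolynomial.aeval (R := R) x : MvPolynomial (Fin 2) R →+* S)
    (by ext r; simp) (by simp)
  simp only [Polynomial.map_id] at hconj
  have hX : MvPolynomial.aeval (R := R) x ∘ MvPolynomial.X = x := funext fun j => by simp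
  simpa [hX] using congr_fun (hconj.iterate_right n MvPolynomial.X) i

theorem isHomogeneous_ratLift_iterate_X (n : ℕ) (i : Fin 2) :
    ((ratLift p q)^[n] (MvPolynomial.X (R := R)) i).IsHomogeneous (ratDegree p q ^ n) := by
  induction n generalizing i with
  | zero => simpa using MvPolynomial.isHomogeneous_X R i
  | succ n ih =>
    rw [Function.iterate_succ_apply', pow_succ]
    fin_cases i <;> exact (isHomogeneous_homogenize _).aeval _ ih

theorem coeff_aeval_one_X {G : MvPolynomial (Fin 2) R} {N : ℕ} (hG : G.IsHomogeneous N)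
    (e : Fin 2 →₀ ℕ) (he : e 0 + e 1 = N) :
    (MvPolynomial.aeval ![(1 : R[X]), X] G).coeff (e 1) = G.coeff e := by
  have hmonomial : ∀ m : Fin 2 →₀ ℕ, MvPolynomial.aeval ![(1 : R[X]), X]
      (MvPolynomial.monomial m (G.coeff m)) = C (G.coeff m) * X ^ m 1 := fun m => by
    simp [MvPolynomial.aeval_monomial, Finsupp.prod_fintype]
  conv_lhs => rw [G.as_sum, map_sum]
  simp only [hmonomial, finsetSum_coeff, coeff_C_mul_X_pow]
  rw [Finset.sum_eq_single e, if_pos rfl]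
  · intro m hm hme
    refine if_neg fun h1 => hme ?_
    have hdeg := hG.degree_eq_sum_deg_support hm
    rw [Finset.sum_subset (Finset.subset_univ m.support) fun a _ => Finsupp.notMem_support_iff.mp,
      Fin.sum_univ_two] at hdeg
    ext a
    fin_cases a <;> simp <;> omega
  · intro he'
    rw [if_pos rfl, MvPolynomial.notMem_support_iff.mp he']

end Iterates

section Dynamics

variable {R S I : Type*} [CommRing R] [CommRing S] [Algebra R S] {φ : I → MulRingSeminorm S}
  {P Q : R[X]}

theorem logBounded_ratLift (hd : 1 ≤ ratDegree P Q) (hres : IsUnit (resultant P Q))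
    (hP : IsUnit P.leadingCoeff) (hQ : IsUnit Q.leadingCoeff) {x : I → Fin 2 → S}
    (hx : ∀ i, IsCoprime (x i 0) (x i 1)) :
    LogBounded R φ fun i => Real.log (supSeminorm (φ i) (ratLift P Q (x i))) -
      ratDegree P Q * Real.log (supSeminorm (φ i) (x i)) := by
  simp only [← Real.log_pow]
  exact DominatedBy.logBounded
    (fun i => supSeminorm_pos_of_isCoprime (isCoprime_ratLift hd hres hP hQ (hx i)))
    (fun i => pow_pos (supSeminorm_pos_of_isCoprime (hx i)) _)
    (dominatedBy_supSeminorm_ratLift P Q x) (supSeminorm_pow_dominatedBy_ratLift hd hres hP hQ x)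

theorem logBounded_ratLift_iterate (hd : 2 ≤ ratDegree P Q) (hres : IsUnit (resultant P Q))
    (hP : IsUnit P.leadingCoeff) (hQ : IsUnit Q.leadingCoeff) {x : I → Fin 2 → S}
    (hx : ∀ i, IsCoprime (x i 0) (x i 1)) :
    LogBounded R (fun s : I × ℕ => φ s.1) fun s =>
      Real.log (supSeminorm (φ s.1) ((ratLift P Q)^[s.2] (x s.1))) / (ratDegree P Q : ℝ) ^ s.2 -
        Real.log (supSeminorm (φ s.1) (x s.1)) := by
  have hd1 : 1 ≤ ratDegree P Q := one_le_two.trans hd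
  refine LogBounded.div_pow_sub
    (u := fun i j => Real.log (supSeminorm (φ i) ((ratLift P Q)^[j] (x i))))
    (by exact_mod_cast hd) ?_
  simp only [Function.iterate_succ_apply']
  exact logBounded_ratLift hd1 hres hP hQ fun s : I × ℕ =>
    isCoprime_ratLift_iterate hd1 hres hP hQ (hx s.1) s.2

end Dynamics

section Basin

variable {R : Type*} [CommRing R]

theorem dominatedBy_aeval_of_X_pow_dvd {I : Type*} {φ : I → MulRingSeminorm R}
    {G : MvPolynomial (Fin 2) R} {N r : ℕ} (hG : G.IsHomogeneous N)
    (hr : X ^ r ∣ MvPolynomial.aeval ![(1 : R[X]), X] G) (x : I → Fin 2 → R)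
    (hx : ∀ i, φ i (x i 1) ≤ φ i (x i 0)) :
    DominatedBy R φ (fun i => φ i (MvPolynomial.aeval (x i) G))
      fun i => φ i (x i 1) ^ r * φ i (x i 0) ^ (N - r) := by
  simp only [MvPolynomial.aeval_def, MvPolynomial.eval₂_eq']
  refine DominatedBy.sum _ (fun i => by positivity) fun e he => ?_
  have hdeg : e 0 + e 1 = N := by
    rw [hG.degree_eq_sum_deg_support he, Finset.sum_subset (Finset.subset_univ e.support)
      fun a _ => Finsupp.notMem_support_iff.mp, Fin.sum_univ_two]
  have hre : r ≤ e 1 := by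
    by_contra! hlt
    exact MvPolynomial.mem_support_iff.mp he
      ((coeff_aeval_one_X hG e hdeg).symm.trans (X_pow_dvd_iff.mp hr _ hlt))
  have hmonomial : ∀ i, φ i (∏ a, x i a ^ e a) ≤ φ i (x i 1) ^ r * φ i (x i 0) ^ (N - r) :=
    fun i => by
    have hsplit : N - r = e 0 + (e 1 - r) := by omega
    rw [Fin.prod_univ_two, map_mul, map_pow, map_pow, ← Nat.add_sub_cancel' hre, pow_add,
      hsplit, pow_add, mul_left_comm]
    gcongr
    exact hx i
  simpa only [map_mul, one_mul] using DominatedBy.mul (fun i => apply_nonneg _ _)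
    (fun i => apply_nonneg _ _) (DominatedBy.const (φ := φ) (G.coeff e))
    (DominatedBy.of_le hmonomial)

theorem mulRingSeminorm_le_mul_add_of_lt (φ : MulRingSeminorm R) {y r : R} {M : ℝ}
    (hM : max 1 (φ 2) ≤ M) (h : M * φ r < φ y) : φ y ≤ M * φ (y + r) := by
  have hM0 : 0 ≤ M := zero_le_one.trans ((le_max_left _ _).trans hM)
  have hle : φ y ≤ M * max (φ (y + r)) (φ r) :=
    calc φ y = φ (y + r + -r) := by rw [add_neg_cancel_right]
      _ ≤ max 1 (φ 2) * max (φ (y + r)) (φ (-r)) := mulRingSeminorm_add_le φ _ _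
      _ ≤ M * max (φ (y + r)) (φ r) := by rw [map_neg_eq_map]; gcongr
  rw [mul_max_of_nonneg _ _ hM0] at hle
  exact (le_max_iff.mp hle).resolve_right h.not_ge

theorem mulRingSeminorm_add_bounds_of_lt (φ : MulRingSeminorm R) {y r : R} {M c : ℝ}
    (hM : max 1 (φ 2) ≤ M) (hy : φ y ≤ M * c) (hy' : c ≤ M * φ y) (hr : M ^ 2 * φ r < c) :
    φ (y + r) ≤ M ^ 2 * c ∧ c ≤ M ^ 2 * φ (y + r) := by
  have hM1 : 1 ≤ M := (le_max_left _ _).trans hM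
  have hc : 0 ≤ c := (mul_nonneg (sq_nonneg M) (apply_nonneg φ r)).trans hr.le
  have hr_le : φ r ≤ M * c :=
    calc φ r ≤ M ^ 2 * φ r := le_mul_of_one_le_left (apply_nonneg _ _) (one_le_pow₀ hM1)
      _ ≤ c := hr.le
      _ ≤ M * c := le_mul_of_one_le_left hc hM1
  have hr_lt : M * φ r < φ y := by
    refine lt_of_mul_lt_mul_left ?_ (zero_le_one.trans hM1)
    rw [← mul_assoc, ← sq]
    exact hr.trans_le hy'
  rw [sq, mul_assoc, mul_assoc]
  constructor
  · exact (mulRingSeminorm_add_le φ _ _).trans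
      (mul_le_mul hM (max_le hy hr_le) (by positivity) (by positivity))
  · refine hy'.trans ?_
    gcongr
    exact mulRingSeminorm_le_mul_add_of_lt φ hM hr_lt

theorem pow_mul_pow_mul_pow_lt {a b c : ℝ} (hc : 0 ≤ c) (hb : 0 ≤ b) (h : c * b < a) {r δ : ℕ}
    (hr : r ≠ 0) (hrδ : r ≤ δ) : c ^ r * (b ^ r * a ^ (δ - r)) < a ^ δ := by
  have hcb : 0 ≤ c * b := mul_nonneg hc hb
  rw [← mul_assoc, ← mul_pow, ← pow_mul_pow_sub a hrδ]
  exact mul_lt_mul_of_pos_right (pow_lt_pow_left₀ h hcb hr) (pow_pos (hcb.trans_lt h) _)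

theorem superattracting_step (φ : MulRingSeminorm R) {a b β r h : R} {δ : ℕ} {M T : ℝ}
    (hδ : 2 ≤ δ) (hM : max 1 (φ 2) ≤ M) (hβ : φ β ≤ M) (hβ' : 1 ≤ M * φ β) (hT : 0 ≤ T)
    (hr : φ r ≤ T * (φ b * φ a ^ (δ - 1))) (hh : φ h ≤ T * (φ b ^ 2 * φ a ^ (δ - 2)))
    (hab : M ^ 4 * T * φ b < φ a) :
    φ (β * a ^ δ + r) ≤ M ^ 4 * φ a ^ δ ∧ φ a ^ δ ≤ M ^ 4 * φ (β * a ^ δ + r) ∧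
      M ^ 4 * T * φ h < φ (β * a ^ δ + r) := by
  have hM1 : 1 ≤ M := (le_max_left _ _).trans hM
  have hMT : 0 ≤ M ^ 4 * T := by positivity
  have hr_lt : M ^ 4 * φ r < φ a ^ δ :=
    calc M ^ 4 * φ r ≤ M ^ 4 * (T * (φ b * φ a ^ (δ - 1))) := by gcongr
      _ = (M ^ 4 * T) ^ 1 * (φ b ^ 1 * φ a ^ (δ - 1)) := by ring
      _ < φ a ^ δ := pow_mul_pow_mul_pow_lt hMT (by positivity) hab (by lia) (by lia)
  have hh_lt : M ^ 8 * (T * φ h) < φ a ^ δ :=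
    calc M ^ 8 * (T * φ h) ≤ M ^ 8 * (T * (T * (φ b ^ 2 * φ a ^ (δ - 2)))) := by gcongr
      _ = (M ^ 4 * T) ^ 2 * (φ b ^ 2 * φ a ^ (δ - 2)) := by ring
      _ < φ a ^ δ := pow_mul_pow_mul_pow_lt hMT (by positivity) hab (by lia) hδ
  have hlead : φ (β * a ^ δ) = φ β * φ a ^ δ := by rw [map_mul, map_pow]
  have hM24 : M ^ 2 ≤ M ^ 4 := pow_le_pow_right₀ hM1 (by norm_num)
  have hlead_ge : φ a ^ δ ≤ M * φ (β * a ^ δ) := by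
    rw [hlead, ← mul_assoc]
    exact le_mul_of_one_le_left (by positivity) hβ'
  obtain ⟨hupper, hlower⟩ := mulRingSeminorm_add_bounds_of_lt φ hM
    (hlead.trans_le (by gcongr)) hlead_ge (hr_lt.trans_le' (by gcongr))
  refine ⟨hupper.trans (by gcongr), hlower.trans (by gcongr),
    lt_of_mul_lt_mul_left ?_ (sq_nonneg M)⟩
  calc M ^ 2 * (M ^ 4 * T * φ h) = M ^ 6 * (T * φ h) := by ring
    _ ≤ M ^ 8 * (T * φ h) :=
        mul_le_mul_of_nonneg_right (pow_le_pow_right₀ hM1 (by norm_num)) (by positivity)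
    _ < _ := hh_lt.trans_le hlower

variable {K : Type*} [Field K] [Algebra K R] {P Q : R[X]} {n : ℕ} {β : K}

theorem exists_superattracting_bounds (hfix : X ^ 2 ∣ (ratLift P Q)^[n] ![(1 : R[X]), X] 1)
    (hβ : X ∣ (ratLift P Q)^[n] ![(1 : R[X]), X] 0 - C (algebraMap K R β)) :
    ∃ κ : Multiset R, ∀ (φ : MulRingSeminorm R) (x : Fin 2 → R), φ (x 1) ≤ φ (x 0) →
      φ ((ratLift P Q)^[n] x 0 - algebraMap K R β * x 0 ^ ratDegree P Q ^ n) ≤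
          constBound κ φ * (φ (x 1) * φ (x 0) ^ (ratDegree P Q ^ n - 1)) ∧
        φ ((ratLift P Q)^[n] x 1) ≤
          constBound κ φ * (φ (x 1) ^ 2 * φ (x 0) ^ (ratDegree P Q ^ n - 2)) := by
  let I := {s : MulRingSeminorm R × (Fin 2 → R) // s.1 (s.2 1) ≤ s.1 (s.2 0)}
  let φ : I → MulRingSeminorm R := fun i => i.1.1
  let x : I → Fin 2 → R := fun i => i.1.2
  let G := (ratLift P Q)^[n] (MvPolynomial.X (R := R))
  let δ := ratDegree P Q ^ n
  have hG : ∀ i, (G i).IsHomogeneous δ := isHomogeneous_ratLift_iterate_X P Q n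
  have hG₀ : (G 0 - MvPolynomial.C (algebraMap K R β) * MvPolynomial.X 0 ^ δ).IsHomogeneous δ := by
    simpa using (hG 0).sub (((MvPolynomial.isHomogeneous_X_pow 0 δ).C_mul (algebraMap K R β)))
  obtain ⟨κ₁, hκ₁⟩ := dominatedBy_aeval_of_X_pow_dvd (φ := φ) (r := 1) hG₀
    (by simpa [G, aeval_ratLift_iterate_X] using hβ) x fun i => i.2
  obtain ⟨κ₂, hκ₂⟩ := dominatedBy_aeval_of_X_pow_dvd (φ := φ) (hG 1)
    (by simpa [G, aeval_ratLift_iterate_X] using hfix) x fun i => i.2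
  refine ⟨κ₁ + κ₂, fun ψ y hy => ⟨?_, ?_⟩⟩
  · refine le_trans ?_ (mul_le_mul_of_nonneg_right
      (constBound_mono (Multiset.le_add_right κ₁ κ₂) ψ) (by positivity))
    simpa only [map_sub, map_mul, map_pow, MvPolynomial.aeval_C, MvPolynomial.aeval_X, pow_one,
      Algebra.algebraMap_self, RingHom.id_apply, G, aeval_ratLift_iterate_X]
      using hκ₁ ⟨(ψ, y), hy⟩
  · refine le_trans ?_ (mul_le_mul_of_nonneg_right
      (constBound_mono (Multiset.le_add_left κ₂ κ₁) ψ) (by positivity))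
    simpa only [G, aeval_ratLift_iterate_X] using hκ₂ ⟨(ψ, y), hy⟩

theorem supSeminorm_eq_of_le {φ : MulRingSeminorm R} {x : Fin 2 → R} (h : φ (x 1) ≤ φ (x 0)) :
    supSeminorm φ x = φ (x 0) :=
  le_antisymm (supSeminorm_le (apply_nonneg _ _) (Fin.forall_fin_two.mpr ⟨le_rfl, h⟩))
    (le_supSeminorm φ x 0)

/-- The points which, at the place `φ`, are close to the superattracting point `[1 : 0]`: their
second coordinate is small against the first, by a factor with a contribution `κ` from `R` and a
contribution `μ` from the constants. -/
def basin (κ : Multiset R) (μ : Multiset K) (φ : MulRingSeminorm R) : Set (Fin 2 → R) :=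
  {x | constBound μ φ * constBound κ φ * φ (x 1) < φ (x 0)}

theorem pos_of_mem_basin {κ : Multiset R} {μ : Multiset K} {φ : MulRingSeminorm R} {x : Fin 2 → R}
    (hx : x ∈ basin κ μ φ) : 0 < φ (x 0) :=
  (mul_nonneg (mul_pos (constBound_pos μ φ) (constBound_pos κ φ)).le
    (apply_nonneg φ _)).trans_lt hx

theorem supSeminorm_eq_of_mem_basin {κ : Multiset R} {μ : Multiset K} {φ : MulRingSeminorm R}
    {x : Fin 2 → R} (hx : x ∈ basin κ μ φ) : supSeminorm φ x = φ (x 0) :=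
  supSeminorm_eq_of_le (le_trans (le_mul_of_one_le_left (apply_nonneg _ _)
    (one_le_mul_of_one_le_of_one_le (one_le_constBound _ _) (one_le_constBound _ _))) (le_of_lt hx))

theorem exists_basin (hδ : 2 ≤ ratDegree P Q ^ n) (hβ0 : β ≠ 0)
    (hfix : X ^ 2 ∣ (ratLift P Q)^[n] ![(1 : R[X]), X] 1)
    (hβ : X ∣ (ratLift P Q)^[n] ![(1 : R[X]), X] 0 - C (algebraMap K R β)) :
    ∃ (κ : Multiset R) (μ : Multiset K), ∀ φ : MulRingSeminorm R, ∀ x ∈ basin κ μ φ,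
      (ratLift P Q)^[n] x ∈ basin κ μ φ ∧
        |Real.log (supSeminorm φ ((ratLift P Q)^[n] x)) -
          (ratDegree P Q ^ n : ℕ) * Real.log (supSeminorm φ x)| ≤ Real.log (constBound μ φ) := by
  obtain ⟨κ, hκ⟩ := exists_superattracting_bounds hfix hβ
  refine ⟨κ, 4 • {2, β, β⁻¹}, fun φ x hx => ?_⟩
  have hsup := supSeminorm_eq_of_mem_basin hx
  have hx0 : 0 < φ (x 0) := pos_of_mem_basin hx
  simp only [basin, constBound_nsmul, Set.mem_ofPred_eq] at hx
  set M := constBound ({2, β, β⁻¹} : Multiset K) φ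
  have hM1 : 1 ≤ M := one_le_constBound _ _
  have hM2 : max 1 (φ 2) ≤ M :=
    max_le hM1 (map_ofNat (algebraMap K R) 2 ▸ le_constBound φ (by simp))
  have hβ_inv : 1 ≤ M * φ (algebraMap K R β) :=
    calc 1 = φ (algebraMap K R β⁻¹) * φ (algebraMap K R β) := by
          rw [← map_mul, ← map_mul, inv_mul_cancel₀ hβ0, map_one, map_one]
      _ ≤ M * φ (algebraMap K R β) := by
          gcongr
          exact le_constBound φ (by simp)
  obtain ⟨hr, hh⟩ := hκ φ x (hsup ▸ le_supSeminorm φ x 1)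
  obtain ⟨hupper, hlower, hmem⟩ := superattracting_step φ hδ hM2 (le_constBound φ (by simp)) hβ_inv
    (constBound_pos κ φ).le hr hh hx
  rw [add_sub_cancel] at hupper hlower hmem
  have hmem' : (ratLift P Q)^[n] x ∈ basin κ (4 • {2, β, β⁻¹} : Multiset K) φ := by
    simpa only [basin, constBound_nsmul, Set.mem_ofPred_eq] using hmem
  refine ⟨hmem', ?_⟩
  rw [supSeminorm_eq_of_mem_basin hmem', hsup, ← Real.log_pow, constBound_nsmul]
  exact abs_log_sub_log_le (pos_of_mul_pos_right ((pow_pos hx0 _).trans_le hlower) (by positivity))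
    (pow_pos hx0 _) hupper hlower

theorem exists_basin_iterate (hδ : 2 ≤ ratDegree P Q ^ n) (hβ0 : β ≠ 0)
    (hfix : X ^ 2 ∣ (ratLift P Q)^[n] ![(1 : R[X]), X] 1)
    (hβ : X ∣ (ratLift P Q)^[n] ![(1 : R[X]), X] 0 - C (algebraMap K R β)) :
    ∃ (κ : Multiset R) (μ : Multiset K), ∀ φ : MulRingSeminorm R, ∀ x ∈ basin κ μ φ, ∀ j : ℕ,
      |Real.log (supSeminorm φ ((ratLift P Q)^[n * j] x)) / (ratDegree P Q : ℝ) ^ (n * j) -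
        Real.log (supSeminorm φ x)| ≤ Real.log (constBound μ φ) := by
  obtain ⟨κ, μ, h⟩ := exists_basin hδ hβ0 hfix hβ
  refine ⟨κ, μ, fun φ x hx j => ?_⟩
  have hmem : ∀ i, ((ratLift P Q)^[n])^[i] x ∈ basin κ μ φ := fun i => by
    induction i with
    | zero => exact hx
    | succ i ih => rw [Function.iterate_succ_apply']; exact (h φ _ ih).1
  rw [Function.iterate_mul, pow_mul, ← Nat.cast_pow]
  refine abs_div_pow_sub_le
    (u := fun i => Real.log (supSeminorm φ (((ratLift P Q)^[n])^[i] x)))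
    (by exact_mod_cast hδ) (fun i => ?_) j
  rw [Function.iterate_succ_apply']
  exact (h φ _ (hmem i)).2

end Basin

section Complement

variable {K R I : Type*} [Field K] [CommRing R] [Algebra K R] {φ : I → MulRingSeminorm R}
  {τ : I → ℝ}

theorem LogBounded.of_constBound_dominatedBy_one {A : I → ℝ} (hA : LogBounded R φ A)
    (h : ∀ κ : Multiset R, DominatedBy K φ (fun i => constBound κ (φ i)) fun _ => 1) :
    LogBounded K φ A := by
  obtain ⟨κ, hκ⟩ := hA
  obtain ⟨κ', hκ'⟩ := h κ
  exact ⟨κ', fun i => (hκ i).trans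
    (Real.log_le_log (constBound_pos _ _) ((hκ' i).trans_eq (mul_one _)))⟩

theorem DominatedBy.of_pow_dominatedBy_pow {m n : ℕ} (hτ : ∀ i, 0 < τ i) (hmn : m < n)
    (h : DominatedBy K φ (fun i => τ i ^ n) fun i => τ i ^ m) : DominatedBy K φ τ fun _ => 1 := by
  refine DominatedBy.of_pow (Nat.sub_ne_zero_of_lt hmn) (fun _ => zero_le_one) ?_
  obtain ⟨κ, hκ⟩ := h
  refine ⟨κ, fun i => ?_⟩
  beta_reduce
  rw [one_pow, mul_one, pow_sub₀ _ (hτ i).ne' hmn.le, ← div_eq_mul_inv,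
    div_le_iff₀ (pow_pos (hτ i) _)]
  exact hκ i

theorem dominatedBy_one_of_notMem_basin {κ : Multiset R} {μ : Multiset K} {x : Fin 2 → R}
    {D D₀ D₁ : ℕ} (hτ : ∀ i, 0 < τ i)
    (hκ : DominatedBy K φ (fun i => constBound κ (φ i)) fun i => τ i ^ D)
    (hx : DominatedBy K φ (fun i => τ i ^ D₀) fun i => supSeminorm (φ i) x)
    (hx₁ : DominatedBy K φ (fun i => φ i (x 1)) fun i => τ i ^ D₁) (hD : D + D₁ < D₀)
    (hbasin : ∀ i, x ∉ basin κ μ (φ i)) : DominatedBy K φ τ fun _ => 1 := by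
  refine DominatedBy.of_pow_dominatedBy_pow hτ hD (hx.trans (DominatedBy.trans (g := fun i =>
    constBound κ (φ i) * φ i (x 1)) ⟨μ, fun i => ?_⟩ ?_))
  · rw [← mul_assoc]
    have h1 : 1 ≤ constBound μ (φ i) * constBound κ (φ i) :=
      one_le_mul_of_one_le_of_one_le (one_le_constBound _ _) (one_le_constBound _ _)
    exact supSeminorm_le (by positivity) (Fin.forall_fin_two.mpr
      ⟨not_lt.mp (hbasin i), le_mul_of_one_le_left (apply_nonneg _ _) h1⟩)
  · simpa only [pow_add] using
      hκ.mul (fun i => (constBound_pos _ _).le) (fun i => apply_nonneg _ _) hx₁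

end Complement

section Variation

variable {K R I : Type*} [Field K] [CommRing R] [Algebra K R] {φ : I → MulRingSeminorm R}
  {τ : I → ℝ} {P Q : R[X]}

theorem exists_logBounded_iterate (hd : 2 ≤ ratDegree P Q) (hres : IsUnit (resultant P Q))
    (hP : IsUnit P.leadingCoeff) (hQ : IsUnit Q.leadingCoeff) {n : ℕ} (hn : n ≠ 0) {β : K}
    (hβ0 : β ≠ 0) (hfix : X ^ 2 ∣ (ratLift P Q)^[n] ![(1 : R[X]), X] 1)
    (hβ : X ∣ (ratLift P Q)^[n] ![(1 : R[X]), X] 0 - C (algebraMap K R β))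
    (hτ : ∀ i, 0 < τ i)
    (hpow : ∀ κ : Multiset R, ∃ D : ℕ,
      DominatedBy K φ (fun i => constBound κ (φ i)) fun i => τ i ^ D) :
    ∃ D : ℕ, ∀ (x : Fin 2 → R) (D₀ D₁ : ℕ), IsCoprime (x 0) (x 1) →
      DominatedBy K φ (fun i => τ i ^ D₀) (fun i => supSeminorm (φ i) x) →
      DominatedBy K φ (fun i => φ i (x 1)) (fun i => τ i ^ D₁) → D + D₁ < D₀ →
      LogBounded K (fun s : I × ℕ => φ s.1) fun s =>
        Real.log (supSeminorm (φ s.1) ((ratLift P Q)^[n * s.2] x)) /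
          (ratDegree P Q : ℝ) ^ (n * s.2) - Real.log (supSeminorm (φ s.1) x) := by
  obtain ⟨κ, μ, hbasin⟩ := exists_basin_iterate (hd.trans (Nat.le_self_pow hn _)) hβ0 hfix hβ
  obtain ⟨D, hD⟩ := hpow κ
  refine ⟨D, fun x D₀ D₁ hx hx₀ hx₁ hlt => LogBounded.of_cases
    {s | x ∈ basin κ μ (φ s.1)} ⟨μ, fun s => hbasin _ x s.2 _⟩ ?_⟩
  let S : Set I := {i | x ∉ basin κ μ (φ i)}
  have hτ_le : DominatedBy K (fun i : S => φ i) (fun i => τ i) fun _ => 1 :=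
    dominatedBy_one_of_notMem_basin (fun i => hτ i) (hD.comp _) (hx₀.comp _) (hx₁.comp _) hlt
      fun i => i.2
  have hone : ∀ κ : Multiset R,
      DominatedBy K (fun i : S => φ i) (fun i => constBound κ (φ i)) fun _ => 1 := fun κ => by
    obtain ⟨E, hE⟩ := hpow κ
    simpa only [one_pow] using
      (hE.comp fun i : S => (i : I)).trans (hτ_le.pow (fun i : S => (hτ i).le) E)
  have hbounded : LogBounded K (fun s : S × ℕ => φ s.1) fun s =>
      Real.log (supSeminorm (φ s.1) ((ratLift P Q)^[s.2] x)) / (ratDegree P Q : ℝ) ^ s.2 -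
        Real.log (supSeminorm (φ s.1) x) :=
    (logBounded_ratLift_iterate (φ := fun i : S => φ i) (x := fun _ => x) hd hres hP hQ
      fun _ => hx).of_constBound_dominatedBy_one fun κ => (hone κ).comp Prod.fst
  exact hbounded.comp fun s : ↥{s : I × ℕ | x ∈ basin κ μ (φ s.1)}ᶜ =>
    ((⟨s.1.1, s.2⟩ : S), n * s.1.2)

end Variation

/-! ### Regular functions on curves -/

section Finiteness

variable {K F : Type*} [Field K] [Field F] [Algebra K F]

theorem IsCurveFunctionField.finiteDimensional_adjoin (hF : IsCurveFunctionField K F) {t : F}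
    (ht : Transcendental K t) : FiniteDimensional (IntermediateField.adjoin K {t}) F := by
  have hbasis : IsTranscendenceBasis K (fun _ : Unit => t) :=
    (algebraicIndependent_unique_type_iff.mpr ht).isTranscendenceBasis_of_lift_trdeg_le_of_finite
      (by simp [hF.trdeg_eq_one])
  have halg := hbasis.isAlgebraic_field
  rw [Set.range_const] at halg
  have : Algebra.EssFiniteType K F := IntermediateField.fg_top_iff.mp hF.fg
  have : Algebra.EssFiniteType (IntermediateField.adjoin K {t}) F :=
    Algebra.EssFiniteType.of_comp K _ F
  exact Algebra.finite_of_essFiniteType_of_isAlgebraic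

theorem eq_zero_of_sum_aeval_mul_eq_zero {A ι : Type*} [CommRing A] [IsDomain A] [Algebra K A]
    [Fintype ι] {t : A} (ht : t ≠ 0) {v : ι → A}
    (hv : LinearIndependent K fun i => Ideal.Quotient.mk (Ideal.span {t}) (v i)) {p : ι → K[X]}
    (hp : ∑ i, aeval t (p i) * v i = 0) : p = 0 := by
  have hX : ∀ q : ι → K[X], ∑ i, aeval t (q i) * v i = 0 → ∀ i, X ∣ q i := fun q hq i => by
    have hmod : ∑ i, (q i).coeff 0 • Ideal.Quotient.mk (Ideal.span {t}) (v i) = 0 := by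
      rw [← map_zero (Ideal.Quotient.mk (Ideal.span {t})), ← hq, map_sum]
      refine Finset.sum_congr rfl fun i _ => ?_
      rw [map_mul, Algebra.smul_def, coeff_zero_eq_aeval_zero', ← Ideal.Quotient.mkₐ_eq_mk K,
        ← aeval_algHom_apply, Ideal.Quotient.mkₐ_eq_mk,
        Ideal.Quotient.eq_zero_iff_mem.mpr (Ideal.mem_span_singleton_self t)]
    exact X_dvd_iff.mpr (Fintype.linearIndependent_iff.mp hv _ hmod i)
  have hpow : ∀ (N : ℕ) (q : ι → K[X]), ∑ i, aeval t (q i) * v i = 0 → ∀ i, X ^ N ∣ q i := by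
    intro N
    induction N with
    | zero => simp
    | succ N ih =>
      intro q hq
      choose r hr using hX q hq
      have hr0 : ∑ i, aeval t (r i) * v i = 0 := by
        simp only [hr, map_mul, aeval_X, mul_assoc, ← Finset.mul_sum] at hq
        exact (mul_eq_zero.mp hq).resolve_left ht
      intro i
      rw [hr i, pow_succ']
      exact mul_dvd_mul_left X (ih r hr0 i)
  ext1 i
  exact eq_zero_of_dvd_of_natDegree_lt (hpow _ p hp i)
    ((Nat.lt_succ_self _).trans_eq (natDegree_X_pow _).symm)

open scoped IntermediateField.algebraAdjoinAdjoin in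
theorem linearIndependent_adjoin_of_quotient {A : Subalgebra K F} {ι : Type*} [Finite ι] {t : A}
    (ht : t ≠ 0) {v : ι → A}
    (hv : LinearIndependent K fun i => Ideal.Quotient.mk (Ideal.span {t}) (v i)) :
    LinearIndependent (IntermediateField.adjoin K {(t : F)}) fun i => (v i : F) := by
  have := Fintype.ofFinite ι
  rw [← LinearIndependent.iff_fractionRing (Algebra.adjoin K {(t : F)}),
    Fintype.linearIndependent_iff]
  intro g hg
  have hpoly : ∀ i, ∃ p : K[X], aeval (t : F) p = g i := fun i =>
    (Algebra.adjoin_singleton_eq_range_aeval K (t : F)).le (g i).2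
  choose p hp using hpoly
  have hcoe : ∀ i, ((aeval t (p i) : A) : F) = g i := fun i => by
    rw [← hp i]
    exact (aeval_algHom_apply A.val t (p i)).symm
  have hp0 : p = 0 := eq_zero_of_sum_aeval_mul_eq_zero ht hv <| Subtype.ext <| by
    simpa [hcoe, Algebra.smul_def] using hg
  intro i
  exact Subtype.ext (by rw [← hp i, hp0]; simp)

theorem IsCurveFunctionField.finite_quotient_span (hF : IsCurveFunctionField K F)
    (A : Subalgebra K F) {t : A} (ht : Transcendental K (t : F)) :
    Module.Finite K (A ⧸ Ideal.span {t}) := by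
  have := hF.finiteDimensional_adjoin ht
  have ht0 : t ≠ 0 := by
    rintro rfl
    exact ht isAlgebraic_zero
  have : Module.Free K (A ⧸ Ideal.span {t}) := Module.Free.of_divisionRing K _
  refine Module.rank_lt_aleph0_iff.mp (lt_of_le_of_lt (rank_le fun s hs => ?_)
    (Cardinal.natCast_lt_aleph0 (n := Module.finrank (IntermediateField.adjoin K {(t : F)}) F)))
  choose v hv using fun i : s => Ideal.Quotient.mk_surjective (i : A ⧸ Ideal.span {t})
  have hlin : LinearIndependent K fun i => Ideal.Quotient.mk (Ideal.span {t}) (v i) := by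
    simpa only [hv] using hs
  exact (Fintype.card_coe s).symm.trans_le
    (linearIndependent_adjoin_of_quotient ht0 hlin).fintype_card_le_finrank

end Finiteness

section Subalgebras

variable {K F : Type*} [Field K] [Field F] [Algebra K F]

theorem transcendental_of_not_isUnit {A : Subalgebra K F} {t : A} (ht : t ≠ 0)
    (hunit : ¬ IsUnit t) : Transcendental K (t : F) := fun halg =>
  hunit (((isAlgebraic_algHom_iff A.val Subtype.val_injective).mp halg).isIntegral.isUnit ht)

theorem IsCurveFunctionField.isNoetherianRing (hF : IsCurveFunctionField K F)
    (A : Subalgebra K F) : IsNoetherianRing A := by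
  refine ⟨fun I => ?_⟩
  rcases eq_or_ne I ⊥ with rfl | hI
  · exact Submodule.fg_bot
  obtain ⟨t, htI, ht⟩ := I.ne_bot_iff.mp hI
  by_cases hunit : IsUnit t
  · rw [Ideal.eq_top_of_isUnit_mem I htI hunit]
    exact Module.Finite.fg_top
  have := hF.finite_quotient_span A (transcendental_of_not_isUnit ht hunit)
  have : IsNoetherian A (A ⧸ Ideal.span {t}) := isNoetherian_of_tower K inferInstance
  refine Submodule.fg_of_fg_map_of_fg_inf_ker (Ideal.span {t}).mkQ (IsNoetherian.noetherian _) ?_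
  rw [Submodule.ker_mkQ, inf_eq_right.mpr ((Ideal.span_singleton_le_iff_mem I).mpr htI)]
  exact Submodule.fg_span_singleton t

theorem IsCurveFunctionField.isDiscreteValuationRing (hF : IsCurveFunctionField K F)
    (A : Subalgebra K F) [ValuationRing A] (hA : ¬ IsField A) : IsDiscreteValuationRing A := by
  have := hF.isNoetherianRing A
  exact ((IsDiscreteValuationRing.TFAE A hA).out 0 1).mpr ‹_›

theorem IsCurveFunctionField.finite_range (hF : IsCurveFunctionField K F) {A : Subalgebra K F}
    {y : A} (hy : Transcendental K (y : F)) {E : Type*} [Field E] [Algebra K E]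
    [Algebra.IsAlgebraic K E] (f : A →ₐ[K] E) : Module.Finite K f.range := by
  have hint : IsIntegral K (f y) := Algebra.IsIntegral.isIntegral _
  have hker : f (aeval y (minpoly K (f y))) = 0 := by
    rw [← aeval_algHom_apply, minpoly.aeval]
  have htrans : Transcendental K ((aeval y (minpoly K (f y)) : A) : F) := by
    rw [← Subalgebra.coe_val, ← aeval_algHom_apply]
    exact hy.aeval _ (minpoly.natDegree_pos hint).ne' (by simp [minpoly.monic hint])
  have := hF.finite_quotient_span A htrans
  let g : (A ⧸ Ideal.span {aeval y (minpoly K (f y))}) →ₐ[K] E :=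
    Ideal.Quotient.liftₐ _ f fun x hx => by
      obtain ⟨z, rfl⟩ := Ideal.mem_span_singleton'.mp hx
      rw [map_mul, hker, mul_zero]
  have hrange : f.range ≤ g.range := by
    rintro _ ⟨x, rfl⟩
    exact ⟨Ideal.Quotient.mk _ x, Ideal.Quotient.liftₐ_apply ..⟩
  have : Module.Finite K g.range := Module.Finite.range g.toLinearMap
  exact FiniteDimensional.of_injective (Subalgebra.inclusion hrange).toLinearMap
    (Subalgebra.inclusion_injective hrange)

end Subalgebras

namespace Place

variable {K F : Type*} [Field K] [Field F] [Algebra K F]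

theorem val_le_one_iff (p : Place K F) (x : F) : p.val x ≤ 1 ↔ x ∈ p.ring := by
  refine ⟨fun h => ?_, fun h => ?_⟩
  · obtain ⟨y, rfl⟩ := IsDiscreteValuationRing.exists_lift_of_le_one h
    exact y.2
  · exact IsDedekindDomain.HeightOneSpectrum.valuation_le_one
      (IsDiscreteValuationRing.maximalIdeal p.ring) (⟨x, h⟩ : p.ring)

theorem val_algebraMap (p : Place K F) {c : K} (hc : c ≠ 0) : p.val (algebraMap K F c) = 1 := by
  refine le_antisymm ((p.val_le_one_iff _).mpr (p.ring.algebraMap_mem c)) ?_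
  have hinv := (p.val_le_one_iff _).mpr (p.ring.algebraMap_mem c⁻¹)
  rw [map_inv₀, map_inv₀] at hinv
  exact (inv_le_one₀ (zero_lt_iff.mpr (by simpa using hc))).mp hinv

theorem mem_regularRing_iff (η : Place K F) (x : F) :
    x ∈ η.regularRing ↔ ∀ p : Place K F, p ≠ η → p.val x ≤ 1 := by
  simp only [regularRing, Algebra.mem_iInf, val_le_one_iff]

theorem val_coe_le_one {η p : Place K F} (hp : p ≠ η) (x : η.regularRing) : p.val (x : F) ≤ 1 :=
  (mem_regularRing_iff η x).mp x.2 p hp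

end Place

theorem IsCurveFunctionField.exists_place {K F : Type*} [Field K] [Field F] [Algebra K F]
    (hF : IsCurveFunctionField K F) (V : ValuationSubring F)
    (hK : ∀ c : K, algebraMap K F c ∈ V) (hV : V ≠ ⊤) :
    ∃ p : Place K F, ∀ x, p.val x ≤ 1 ↔ x ∈ V := by
  let A : Subalgebra K F := { V.toSubring with algebraMap_mem' := hK }
  have : ValuationRing A := inferInstanceAs (ValuationRing V)
  have hfrac : IsFractionRing A F := inferInstanceAs (IsFractionRing V F)
  have hfield : ¬ IsField A := fun h => hV <| eq_top_iff.mpr fun x _ => by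
    obtain ⟨y, rfl⟩ := (IsFractionRing.surjective_iff_isField (K := F)).mpr h x
    exact y.2
  exact ⟨⟨A, hF.isDiscreteValuationRing A hfield, hfrac⟩, Place.val_le_one_iff _⟩

section Comparison

theorem dominatedBy_of_pow_eq_sum {k R I ι : Type*} [CommRing k] [CommRing R] [Algebra k R]
    [Finite ι] (φ : I → MulRingSeminorm R) {y : R} {x : ι → R} {r : ℕ}
    {G : ℕ → MvPolynomial ι k} (hG : ∀ j, (G j).IsHomogeneous (j + 1))
    (hy : y ^ (r + 1) = ∑ j ∈ Finset.range (r + 1), MvPolynomial.aeval x (G j) * y ^ (r - j)) :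
    DominatedBy k φ (fun i => φ i y) fun i => supSeminorm (φ i) x := by
  have hsup : ∀ i, 0 ≤ supSeminorm (φ i) x := fun i => supSeminorm_nonneg (φ i) x
  let S : Set I := {i | φ i y ≤ supSeminorm (φ i) x}
  refine .of_cases S hsup (.of_le fun i => i.2) ?_
  have hlt : ∀ i : ↥Sᶜ, supSeminorm (φ i) x < φ i y := fun i => not_le.mp i.2
  have hterm : ∀ j ∈ Finset.range (r + 1), DominatedBy k (fun i : ↥Sᶜ => φ i)
      (fun i => φ i (MvPolynomial.aeval x (G j) * y ^ (r - j)))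
      fun i => supSeminorm (φ i) x * φ i y ^ r := fun j hj => by
    simp only [map_mul, map_pow]
    refine (DominatedBy.mul (fun i => apply_nonneg _ _) (fun i => by positivity)
      (dominatedBy_aeval_of_isHomogeneous (hG j) fun _ => x) (.of_le fun i => le_rfl)).trans_le
      fun i => ?_
    rw [pow_succ', mul_assoc]
    refine mul_le_mul_of_nonneg_left ?_ (hsup i)
    calc supSeminorm (φ i) x ^ j * φ i y ^ (r - j) ≤ φ i y ^ j * φ i y ^ (r - j) := by
          gcongr
          exacts [hsup i, (hlt i).le]
      _ = φ i y ^ r := by rw [← pow_add, Nat.add_sub_cancel' (Finset.mem_range_succ_iff.mp hj)]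
  obtain ⟨κ, hκ⟩ := DominatedBy.sum (Finset.range (r + 1))
    (fun i : ↥Sᶜ => mul_nonneg (hsup i) (pow_nonneg (apply_nonneg (φ i) y) r)) hterm
  refine ⟨κ, fun i => le_of_mul_le_mul_right ?_ (pow_pos ((hsup i).trans_lt (hlt i)) r)⟩
  rw [mul_assoc, ← pow_succ', ← map_pow, hy]
  exact hκ i

theorem aeval_mul_of_isHomogeneous {k R ι : Type*} [CommRing k] [CommRing R] [Algebra k R]
    {G : MvPolynomial ι k} {n : ℕ} (hG : G.IsHomogeneous n) (c : R) (x : ι → R) :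
    MvPolynomial.aeval (fun i => c * x i) G = c ^ n * MvPolynomial.aeval x G := by
  simp only [MvPolynomial.aeval_def, MvPolynomial.eval₂_eq, Finset.mul_sum]
  refine Finset.sum_congr rfl fun e he => ?_
  simp only [mul_pow, Finset.prod_mul_distrib, Finset.prod_pow_eq_pow_sum]
  rw [hG.degree_eq_sum_deg_support he]
  ring

variable {K F ι : Type*} [Field K] [Field F] [Algebra K F]

theorem pow_eq_sum_of_aeval_div_eq_one {x : ι → F} {y : F} (hy : y ≠ 0) {G : MvPolynomial ι K}
    (hG0 : MvPolynomial.constantCoeff G = 0)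
    (hG : MvPolynomial.aeval (fun i => y⁻¹ * x i) G = 1) :
    y ^ (G.totalDegree + 1) = ∑ j ∈ Finset.range (G.totalDegree + 1),
      MvPolynomial.aeval x (G.homogeneousComponent (j + 1)) * y ^ (G.totalDegree - j) := by
  have hsum : G = ∑ j ∈ Finset.range (G.totalDegree + 1), G.homogeneousComponent (j + 1) := by
    have htop := MvPolynomial.homogeneousComponent_eq_zero _ G (Nat.lt_succ_self G.totalDegree)
    have h := Finset.sum_range_succ (fun j => G.homogeneousComponent j) (G.totalDegree + 1)
    rw [Finset.sum_range_succ', htop, MvPolynomial.homogeneousComponent_zero,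
      MvPolynomial.sum_homogeneousComponent] at h
    rw [MvPolynomial.constantCoeff_eq] at hG0
    simpa [hG0] using h.symm
  have h1 := hG
  rw [hsum, map_sum] at h1
  rw [← mul_one (y ^ _), ← h1, Finset.mul_sum]
  refine Finset.sum_congr rfl fun j hj => ?_
  rw [aeval_mul_of_isHomogeneous (MvPolynomial.homogeneousComponent_isHomogeneous _ _),
    ← pow_mul_pow_sub y (Nat.succ_le_of_lt (Finset.mem_range.mp hj)), Nat.succ_eq_add_one,
    Nat.add_sub_add_right, inv_pow]
  field_simp

theorem IsCurveFunctionField.exists_aeval_eq_one (hF : IsCurveFunctionField K F) {z : ι → F}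
    (hz : z ≠ 0) (h : ∀ p : Place K F, ∃ i, 1 ≤ p.val (z i)) :
    ∃ G : MvPolynomial ι K, MvPolynomial.constantCoeff G = 0 ∧ MvPolynomial.aeval z G = 1 := by
  let ev : MvPolynomial ι K →ₐ[K] F := MvPolynomial.aeval z
  let I : Ideal ev.range := (RingHom.ker (MvPolynomial.constantCoeff (R := K))).map ev.rangeRestrict
  have hzI : ∀ i, ev.rangeRestrict (MvPolynomial.X i) ∈ I := fun i =>
    Ideal.mem_map_of_mem _ (RingHom.mem_ker.mpr (MvPolynomial.constantCoeff_X K i))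
  have hI : I = ⊤ := by
    by_contra hI
    obtain ⟨V, hAV, hIV⟩ := Ideal.image_subset_nonunits_valuationSubring
      (A := ev.range.toSubring) I hI
    have hzV : ∀ i, z i ∈ V.nonunits := fun i =>
      hIV ⟨_, hzI i, MvPolynomial.aeval_X z i⟩
    have hV : V ≠ ⊤ := fun htop => hz <| funext fun i =>
      (V.mem_nonunits_iff_or.mp (hzV i)).resolve_right (by simp [htop])
    obtain ⟨p, hp⟩ := hF.exists_place V (fun c => hAV (Subalgebra.algebraMap_mem _ c)) hV
    obtain ⟨i, hi⟩ := h p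
    rcases V.mem_nonunits_iff_or.mp (hzV i) with hi0 | hinv
    · simp [hi0] at hi
    · rw [← hp, map_inv₀] at hinv
      exact hinv (inv_le_one_of_one_le₀ hi)
  obtain ⟨G, hG, hG1⟩ := (Ideal.mem_map_iff_of_surjective _
    ev.rangeRestrict_surjective).mp ((Ideal.eq_top_iff_one I).mp hI)
  exact ⟨G, hG, congrArg Subtype.val hG1⟩

variable {η : Place K F} {I : Type*}

theorem IsCurveFunctionField.dominatedBy_supSeminorm [Fintype ι] (hF : IsCurveFunctionField K F)
    (φ : I → MulRingSeminorm η.regularRing) {y : η.regularRing} {x : ι → η.regularRing}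
    (h : ∀ p : Place K F, p.val (y : F) ≤ Finset.univ.sup fun i => p.val (x i : F)) :
    DominatedBy K φ (fun i => φ i y) fun i => supSeminorm (φ i) x := by
  rcases eq_or_ne y 0 with rfl | hy
  · exact .of_le fun i => by simpa using supSeminorm_nonneg (φ i) x
  have hyF : (y : F) ≠ 0 := by simpa using hy
  have hle : ∀ p : Place K F, ∃ i, 1 ≤ p.val ((y : F)⁻¹ * x i) := fun p => by
    have hpos : 0 < p.val (y : F) := zero_lt_iff.mpr ((Valuation.ne_zero_iff _).mpr hyF)
    obtain ⟨i, -, hi⟩ := (Finset.le_sup_iff (bot_lt_iff_ne_bot.mpr hpos.ne')).mp (h p)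
    exact ⟨i, by rwa [map_mul, map_inv₀, le_inv_mul_iff₀ hpos, mul_one]⟩
  have hz : (fun i => (y : F)⁻¹ * x i) ≠ 0 := fun hz => by
    obtain ⟨i, hi⟩ := hle η
    rw [show (y : F)⁻¹ * x i = 0 from congrFun hz i] at hi
    simp at hi
  obtain ⟨G, hG0, hG⟩ := hF.exists_aeval_eq_one hz hle
  refine dominatedBy_of_pow_eq_sum φ (r := G.totalDegree)
    (fun j => MvPolynomial.homogeneousComponent_isHomogeneous (j + 1) G)
    (FaithfulSMul.algebraMap_injective η.regularRing F ?_)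
  simp only [map_pow, map_sum, map_mul, ← MvPolynomial.aeval_algebraMap_apply]
  exact pow_eq_sum_of_aeval_div_eq_one hyF hG0 hG

theorem IsCurveFunctionField.exists_algebraMap_eq (hF : IsCurveFunctionField K F)
    (y : η.regularRing) (hy : η.val (y : F) ≤ 1) : ∃ c : K, y = algebraMap K η.regularRing c := by
  suffices halg : IsAlgebraic K (y : F) by
    obtain ⟨c, hc⟩ := IntermediateField.mem_bot.mp
      (hF.algClosed.le ((mem_algebraicClosure_iff).mpr halg))
    exact ⟨c, Subtype.ext hc.symm⟩
  rcases eq_or_ne (y : F) 0 with hy0 | hy0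
  · exact hy0 ▸ isAlgebraic_zero
  have hle : ∀ p : Place K F, p.val (y : F) ≤ 1 := fun p => by
    rcases eq_or_ne p η with rfl | hp
    exacts [hy, Place.val_coe_le_one hp y]
  obtain ⟨G, hG0, hG⟩ := hF.exists_aeval_eq_one (z := fun _ : Unit => (y : F)⁻¹)
    (fun h => inv_ne_zero hy0 (congrFun h ())) fun p => ⟨(), by
      rw [map_inv₀]
      exact (one_le_inv₀ (zero_lt_iff.mpr ((Valuation.ne_zero_iff _).mpr hy0))).mpr (hle p)⟩
  refine (IsAlgebraic.inv_iff).mp (not_not.mp fun htrans => ?_)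
  have hG1 := algebraicIndependent_iff.mp
    (algebraicIndependent_unique_type_iff (x := fun _ : Unit => (y : F)⁻¹).mpr htrans) (G - 1)
    (by simp [hG])
  simp [sub_eq_zero.mp hG1] at hG0

theorem IsCurveFunctionField.one_le_val (hF : IsCurveFunctionField K F) {y : η.regularRing}
    (hy : y ≠ 0) : 1 ≤ η.val (y : F) := by
  by_contra! hlt
  obtain ⟨c, rfl⟩ := hF.exists_algebraMap_eq y hlt.le
  have hc : c ≠ 0 := by
    rintro rfl
    exact hy (map_zero _)
  exact hlt.ne (η.val_algebraMap hc)

theorem IsCurveFunctionField.isNonzeroConstant_of_isUnit (hF : IsCurveFunctionField K F)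
    {y : η.regularRing} (hy : IsUnit y) : IsNonzeroConstant K y := by
  obtain ⟨z, hyz⟩ := hy.exists_right_inv
  have hz : z ≠ 0 := right_ne_zero_of_mul_eq_one hyz
  have hval : η.val (y : F) * η.val (z : F) = 1 := by
    rw [← map_mul, ← Subalgebra.coe_mul, hyz, Subalgebra.coe_one, map_one]
  obtain ⟨c, rfl⟩ := hF.exists_algebraMap_eq y
    (hval ▸ le_mul_of_one_le_right' (hF.one_le_val hz))
  exact ⟨c, fun hc => hy.ne_zero (by rw [hc, map_zero]), rfl⟩

end Comparison

section SectionSize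

variable {K F : Type*} [Field K] [Field F] [Algebra K F] {η : Place K F}

theorem IsCurveFunctionField.supSeminorm_dominatedBy {ι κ I : Type*} [Fintype ι] [Fintype κ]
    (hF : IsCurveFunctionField K F) (φ : I → MulRingSeminorm η.regularRing)
    {x : ι → η.regularRing} {y : κ → η.regularRing}
    (h : ∀ p : Place K F, (Finset.univ.sup fun i => p.val (x i : F)) ≤
      Finset.univ.sup fun i => p.val (y i : F)) :
    DominatedBy K φ (fun i => supSeminorm (φ i) x) fun i => supSeminorm (φ i) y :=
  DominatedBy.supSeminorm (fun _ => supSeminorm_nonneg _ _) fun a =>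
    hF.dominatedBy_supSeminorm φ fun p =>
      (Finset.le_sup (f := fun i => p.val (x i : F)) (Finset.mem_univ a)).trans (h p)

theorem sup_pow {ι : Type*} [Fintype ι] [Nonempty ι] (f : ι → ℤᵐ⁰) (n : ℕ) :
    (Finset.univ.sup fun i => f i ^ n) = Finset.univ.sup f ^ n :=
  (Finset.apply_sup_eq_sup_comp_of_nonempty (fun _ _ h => pow_le_pow_left' h n)
    Finset.univ_nonempty).symm

theorem exp_pow_comm (m n : ℕ) : WithZero.exp (m : ℤ) ^ n = WithZero.exp (n : ℤ) ^ m := by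
  rw [← WithZero.exp_nsmul, ← WithZero.exp_nsmul, nsmul_eq_mul, nsmul_eq_mul, mul_comm]

theorem Place.one_le_sup_val_of_isCoprime {p : Place K F} (hp : p ≠ η) {x : Fin 2 → η.regularRing}
    (hx : IsCoprime (x 0) (x 1)) : 1 ≤ Finset.univ.sup fun i => p.val (x i : F) := by
  obtain ⟨u, w, huw⟩ := hx
  have hle : ∀ (c : η.regularRing) i, p.val ((c * x i : η.regularRing) : F) ≤
      Finset.univ.sup fun i => p.val (x i : F) := fun c i => by
    rw [Subalgebra.coe_mul, map_mul]
    exact (mul_le_of_le_one_left' (Place.val_coe_le_one hp c)).trans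
      (Finset.le_sup (f := fun i => p.val (x i : F)) (Finset.mem_univ i))
  calc (1 : ℤᵐ⁰) = p.val ((u * x 0 + w * x 1 : η.regularRing) : F) := by rw [huw]; simp
    _ ≤ Finset.univ.sup fun i => p.val (x i : F) := p.val.map_add_le (hle u 0) (hle w 1)

variable {r m : ℕ} {s : Fin r → η.regularRing}

theorem GeneratesMultiple.nonempty (hs : GeneratesMultiple η m s) : Nonempty (Fin r) := by
  by_contra! hr
  exact WithZero.exp_ne_zero (hs.2.symm.trans (by simp))

theorem GeneratesMultiple.supSeminorm_pos (hs : GeneratesMultiple η m s)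
    (hF : IsCurveFunctionField K F) (φ : MulRingSeminorm η.regularRing) :
    0 < supSeminorm φ s := by
  obtain ⟨κ, hκ⟩ := hF.dominatedBy_supSeminorm (fun _ : Unit => φ) (y := 1) (x := s) fun p => by
    rw [Subalgebra.coe_one, map_one]
    rcases eq_or_ne p η with rfl | hp
    · rw [hs.2, ← WithZero.exp_zero, WithZero.exp_le_exp]
      exact Int.natCast_nonneg m
    · exact (hs.1 p hp).ge
  have h1 : 1 ≤ constBound κ φ * supSeminorm φ s := by simpa using hκ ()
  exact pos_of_mul_pos_right (one_pos.trans_le h1) (constBound_pos κ φ).le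

/-- The `m`-th root of the largest value at `φ` of the generating sections `s` of `𝓞(m η)`: the
local factor at `φ` of a height for the divisor `η`. -/
noncomputable def sectionSize (m : ℕ) (s : Fin r → η.regularRing)
    (φ : MulRingSeminorm η.regularRing) : ℝ :=
  supSeminorm φ s ^ (1 / m : ℝ)

theorem sectionSize_nonneg (φ : MulRingSeminorm η.regularRing) : 0 ≤ sectionSize m s φ :=
  Real.rpow_nonneg (supSeminorm_nonneg φ s) _

theorem sectionSize_pow (hm : m ≠ 0) (φ : MulRingSeminorm η.regularRing) :
    sectionSize m s φ ^ m = supSeminorm φ s := by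
  rw [sectionSize, one_div, Real.rpow_inv_natCast_pow (supSeminorm_nonneg φ s) hm]

theorem log_sectionSize_pow (hs : GeneratesMultiple η m s) (hF : IsCurveFunctionField K F)
    (φ : MulRingSeminorm η.regularRing) (D : ℕ) :
    Real.log (sectionSize m s φ ^ D) = D / m * Real.log (supSeminorm φ s) := by
  rw [sectionSize, Real.log_pow, Real.log_rpow (hs.supSeminorm_pos hF φ)]
  ring

variable {I : Type*} (φ : I → MulRingSeminorm η.regularRing)

section

variable (hF : IsCurveFunctionField K F) (hm : m ≠ 0) (hs : GeneratesMultiple η m s)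
include hF hm hs

theorem dominatedBy_sectionSize_pow {g : η.regularRing} {D : ℕ}
    (hg : η.val (g : F) ≤ WithZero.exp (D : ℤ)) :
    DominatedBy K φ (fun i => φ i g) fun i => sectionSize m s (φ i) ^ D := by
  have := hs.nonempty
  refine DominatedBy.of_pow hm (fun i => pow_nonneg (sectionSize_nonneg _) D) ?_
  simp only [← map_pow, pow_right_comm _ D m, sectionSize_pow hm, ← supSeminorm_pow]
  refine hF.dominatedBy_supSeminorm φ fun p => ?_
  simp only [Pi.pow_apply, Subalgebra.coe_pow, map_pow]
  rw [sup_pow fun i => p.val (s i : F)]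
  rcases eq_or_ne p η with rfl | hp
  · rw [hs.2, exp_pow_comm]
    exact pow_le_pow_left' hg m
  · rw [hs.1 p hp, one_pow]
    exact pow_le_one' (Place.val_coe_le_one hp g) m

theorem sectionSize_pow_dominatedBy {x : Fin 2 → η.regularRing} (hx : IsCoprime (x 0) (x 1))
    {D : ℕ} (hD : WithZero.exp (D : ℤ) ≤ Finset.univ.sup fun i => η.val (x i : F)) :
    DominatedBy K φ (fun i => sectionSize m s (φ i) ^ D) fun i => supSeminorm (φ i) x := by
  have := hs.nonempty
  refine DominatedBy.of_pow hm (fun i => supSeminorm_nonneg _ _) ?_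
  simp only [pow_right_comm _ D m, sectionSize_pow hm, ← supSeminorm_pow]
  refine hF.supSeminorm_dominatedBy φ fun p => ?_
  simp only [Pi.pow_apply, Subalgebra.coe_pow, map_pow]
  rw [sup_pow fun i => p.val (s i : F), sup_pow fun i => p.val (x i : F)]
  rcases eq_or_ne p η with rfl | hp
  · rw [hs.2, exp_pow_comm]
    exact pow_le_pow_left' hD m
  · rw [hs.1 p hp, one_pow]
    exact one_le_pow_of_one_le' (Place.one_le_sup_val_of_isCoprime hp hx) m

theorem exists_constBound_dominatedBy_sectionSize_pow (κ : Multiset η.regularRing) :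
    ∃ D : ℕ, DominatedBy K φ (fun i => constBound κ (φ i)) fun i => sectionSize m s (φ i) ^ D := by
  induction κ using Multiset.induction_on with
  | empty => exact ⟨0, .of_le fun i => by simp [constBound_zero]⟩
  | cons g κ ih =>
    obtain ⟨D, hD⟩ := ih
    let D' := (WithZero.log (η.val (g : F))).toNat
    have hone : DominatedBy K φ (fun _ => 1) fun i => sectionSize m s (φ i) ^ D' := by
      simpa using dominatedBy_sectionSize_pow φ hF hm hs (g := 1) (D := D')
        (by rw [Subalgebra.coe_one, map_one, ← WithZero.exp_zero, WithZero.exp_le_exp]; positivity)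
    have hg : DominatedBy K φ (fun i => φ i g) fun i => sectionSize m s (φ i) ^ D' :=
      dominatedBy_sectionSize_pow φ hF hm hs
        (WithZero.le_exp_of_log_le (Int.self_le_toNat _))
    refine ⟨D' + D, ?_⟩
    simp only [← Multiset.singleton_add, constBound_add, constBound_singleton, pow_add,
      Algebra.algebraMap_self, RingHom.id_apply]
    exact .mul (fun i => by positivity) (fun i => (constBound_pos κ _).le)
      (.max (fun i => pow_nonneg (sectionSize_nonneg _) D') hone hg) hD

end

end SectionSize

section RegularVariation

variable {K F : Type*} [Field K] [Field F] [Algebra K F] {η : Place K F} {P Q : η.regularRing[X]}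

theorem SuperattractingAtInfinity.exists_iterate {R : Type*} [CommRing R] [Algebra R F]
    [FaithfulSMul R F] {P Q : R[X]} (hP : IsUnit P.leadingCoeff) (hQ : IsUnit Q.leadingCoeff)
    (h : SuperattractingAtInfinity (P.map (algebraMap R F)) (Q.map (algebraMap R F))) :
    ∃ n : ℕ, n ≠ 0 ∧ X ^ 2 ∣ (ratLift P Q)^[n] ![(1 : R[X]), X] 1 := by
  obtain ⟨n, hn, h0, h1, hderiv⟩ := h
  have hmap : (ratLift (P.map (algebraMap R F)) (Q.map (algebraMap R F)))^[n] ![1, X] =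
      mapRingHom (algebraMap R F) ∘ (ratLift P Q)^[n] ![1, X] := by
    refine Eq.trans ?_ ((ratLift_semiconj (algebraMap R F) (mapRingHom (algebraMap R F))
      (by ext; simp) (ratDegree_map _ hP hQ)).iterate_right n ![1, X]).symm
    congr 1
    ext i : 1
    fin_cases i <;> simp
  simp only [hmap, Function.comp_apply, coe_mapRingHom, eval_sub, eval_mul,
    ← coeff_zero_eq_eval_zero, coeff_derivative, coeff_map, zero_add, Nat.cast_zero,
    mul_one] at h0 h1 hderiv
  rw [h1, zero_mul, sub_zero, mul_eq_zero, or_iff_left h0] at hderiv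
  have hinj := FaithfulSMul.algebraMap_injective R F
  refine ⟨n, Nat.one_le_iff_ne_zero.mp hn, X_pow_dvd_iff.mpr fun j hj => ?_⟩
  interval_cases j
  exacts [(map_eq_zero_iff _ hinj).mp h1, (map_eq_zero_iff _ hinj).mp hderiv]

theorem isUnit_coeff_zero_of_isCoprime {R : Type*} [CommRing R] {p q : R[X]} (h : IsCoprime p q)
    (hq : q.coeff 0 = 0) : IsUnit (p.coeff 0) := by
  have := h.map constantCoeff
  rwa [constantCoeff_apply, constantCoeff_apply, hq, isCoprime_zero_right] at this

theorem exists_logBounded_sub_log_sectionSize {I : Type*} (φ : I → MulRingSeminorm η.regularRing)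
    (hF : IsCurveFunctionField K F) {m r : ℕ} {s : Fin r → η.regularRing} (hm : m ≠ 0)
    (hs : GeneratesMultiple η m s) {x : Fin 2 → η.regularRing} (hx : IsCoprime (x 0) (x 1)) {D : ℕ}
    (hD : (Finset.univ.sup fun i => η.val (x i : F)) = WithZero.exp (D : ℤ)) :
    LogBounded K φ fun i =>
      Real.log (supSeminorm (φ i) x) - D / m * Real.log (supSeminorm (φ i) s) := by
  simp only [← log_sectionSize_pow hs hF]
  refine DominatedBy.logBounded (fun i => supSeminorm_pos_of_isCoprime hx)
    (fun i => pow_pos (Real.rpow_pos_of_pos (hs.supSeminorm_pos hF _) _) D) ?_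
    (sectionSize_pow_dominatedBy φ hF hm hs hx hD.ge)
  exact DominatedBy.supSeminorm (fun i => pow_nonneg (sectionSize_nonneg _) D) fun a =>
    dominatedBy_sectionSize_pow φ hF hm hs
      ((Finset.le_sup (f := fun i => η.val (x i : F)) (Finset.mem_univ a)).trans hD.le)

theorem IsCurveFunctionField.exists_val_eq_exp (hF : IsCurveFunctionField K F) {y : η.regularRing}
    (hy : y ≠ 0) : ∃ D : ℕ, η.val (y : F) = WithZero.exp (D : ℤ) := by
  have hle := hF.one_le_val hy
  have hlog : 0 ≤ WithZero.log (η.val (y : F)) :=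
    (WithZero.log_one).symm.trans_le (WithZero.log_le_log one_ne_zero
      (zero_lt_one.trans_le hle).ne' |>.mpr hle)
  exact ⟨_, by rw [Int.toNat_of_nonneg hlog, WithZero.exp_log (zero_lt_one.trans_le hle).ne']⟩

theorem IsCurveFunctionField.exists_val_eq_exp_of_lt_deg (hF : IsCurveFunctionField K F)
    {y z : η.regularRing} {D : ℕ} (h : (D : ℤ) < η.deg ((y : F) / z)) :
    ∃ D₀ D₁ : ℕ, η.val (y : F) = WithZero.exp (D₀ : ℤ) ∧ η.val (z : F) = WithZero.exp (D₁ : ℤ) ∧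
      D + D₁ < D₀ := by
  have hyz : (y : F) / z ≠ 0 := fun h0 => by simp [Place.deg, h0] at h; omega
  obtain ⟨hy, hz⟩ := div_ne_zero_iff.mp hyz
  obtain ⟨D₀, hD₀⟩ := hF.exists_val_eq_exp (y := y) (by simpa using hy)
  obtain ⟨D₁, hD₁⟩ := hF.exists_val_eq_exp (y := z) (by simpa using hz)
  rw [Place.deg, map_div₀, hD₀, hD₁, ← WithZero.exp_sub, WithZero.log_exp] at h
  exact ⟨D₀, D₁, hD₀, hD₁, by omega⟩

section

variable {I : Type*} (φ : I → MulRingSeminorm η.regularRing) (hF : IsCurveFunctionField K F)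
  {m r : ℕ} {s : Fin r → η.regularRing} (hm : m ≠ 0) (hs : GeneratesMultiple η m s)
  (hd : 2 ≤ ratDegree P Q) (hres : IsUnit (resultant P Q)) (hP : IsUnit P.leadingCoeff)
  (hQ : IsUnit Q.leadingCoeff)
  (hinf : SuperattractingAtInfinity (P.map (algebraMap η.regularRing F))
    (Q.map (algebraMap η.regularRing F)))
include hF hm hs hd hres hP hQ hinf

theorem exists_logBounded_iterate_sub_of_lt_deg :
    ∃ n D : ℕ, n ≠ 0 ∧ ∀ x : Fin 2 → η.regularRing, IsCoprime (x 0) (x 1) →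
      (D : ℤ) < η.deg ((x 0 : F) / x 1) → ∃ D₀ : ℕ,
        LogBounded K (fun t : I × ℕ => φ t.1) fun t =>
          Real.log (supSeminorm (φ t.1) ((ratLift P Q)^[n * t.2] x)) /
            (ratDegree P Q : ℝ) ^ (n * t.2) - D₀ / m * Real.log (supSeminorm (φ t.1) s) := by
  obtain ⟨n, hn, hfix⟩ := hinf.exists_iterate hP hQ
  have hcop := isCoprime_ratLift_iterate (one_le_two.trans hd) hres hP hQ
    (x := ![(1 : η.regularRing[X]), X]) isCoprime_one_left n
  obtain ⟨β, hβ0, hβ⟩ := hF.isNonzeroConstant_of_isUnit (isUnit_coeff_zero_of_isCoprime hcop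
    (X_pow_dvd_iff.mp hfix 0 two_pos))
  obtain ⟨D, hD⟩ := exists_logBounded_iterate (φ := φ) hd hres hP hQ hn hβ0 hfix
    (X_dvd_iff.mpr (by rw [coeff_sub, coeff_C_zero, hβ, sub_self]))
    (fun i => Real.rpow_pos_of_pos (hs.supSeminorm_pos hF (φ i)) (1 / m : ℝ))
    (exists_constBound_dominatedBy_sectionSize_pow φ hF hm hs)
  refine ⟨n, D, hn, fun x hx hlt => ?_⟩
  obtain ⟨D₀, D₁, hD₀, hD₁, hlt⟩ := hF.exists_val_eq_exp_of_lt_deg hlt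
  have hsup : (Finset.univ.sup fun i => η.val (x i : F)) = WithZero.exp (D₀ : ℤ) := by
    have hle : WithZero.exp (D₁ : ℤ) ≤ WithZero.exp (D₀ : ℤ) := WithZero.exp_le_exp.mpr (by omega)
    simp [Fin.univ_succ, hD₀, hD₁, hle]
  have hiter := hD x D₀ D₁ hx (sectionSize_pow_dominatedBy φ hF hm hs hx hsup.ge)
    (dominatedBy_sectionSize_pow φ hF hm hs hD₁.le) hlt
  have hstart := exists_logBounded_sub_log_sectionSize φ hF hm hs hx hsup
  exact ⟨D₀, by simpa using hiter.add (hstart.comp Prod.fst)⟩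

theorem exists_logBounded_iterate_sub {x : Fin 2 → η.regularRing} (hx : IsCoprime (x 0) (x 1))
    (hdeg : ∀ D : ℕ, ∃ n : ℕ, (D : ℤ) < η.deg
      ((((ratLift P Q)^[n] x 0 : η.regularRing) : F) / ((ratLift P Q)^[n] x 1 : η.regularRing))) :
    ∃ (h : ℝ) (e : ℕ → ℕ), Tendsto e atTop atTop ∧
      LogBounded K (fun t : I × ℕ => φ t.1) fun t =>
        Real.log (supSeminorm (φ t.1) ((ratLift P Q)^[e t.2] x)) / (ratDegree P Q : ℝ) ^ e t.2 -
          h / m * Real.log (supSeminorm (φ t.1) s) := by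
  have hd1 : 1 ≤ ratDegree P Q := one_le_two.trans hd
  obtain ⟨n, D, hn, hD⟩ := exists_logBounded_iterate_sub_of_lt_deg φ hF hm hs hd hres hP hQ hinf
  obtain ⟨n₀, hn₀⟩ := hdeg D
  obtain ⟨D₀, hD₀⟩ := hD _ (isCoprime_ratLift_iterate hd1 hres hP hQ hx n₀) hn₀
  refine ⟨D₀ / (ratDegree P Q : ℝ) ^ n₀, fun j => n * j + n₀, tendsto_atTop_mono
    (fun j => Nat.le_add_right_of_le (Nat.le_mul_of_pos_left j (Nat.pos_of_ne_zero hn)))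
    tendsto_id, ?_⟩
  have hd0 : (1 : ℝ) ≤ (ratDegree P Q : ℝ) ^ n₀ := one_le_pow₀ (by exact_mod_cast hd1)
  have hinv : |((ratDegree P Q : ℝ) ^ n₀)⁻¹| ≤ 1 := by
    rw [abs_of_nonneg (by positivity)]
    exact inv_le_one_of_one_le₀ hd0
  convert hD₀.bdd_mul (fun _ => hinv) using 2 with t
  rw [Function.iterate_add_apply, pow_add]
  field_simp

end

end RegularVariation

/-! ### From local estimates to heights -/

section Pullback

variable {k R S : Type*} [CommRing R] [CommRing S] [Nontrivial S] {f : R →+* S}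

/-- The pullback of an absolute value along a ring homomorphism, as a multiplicative seminorm. -/
def pullbackSeminorm (f : R →+* S) (v : AbsoluteValue S ℝ) : MulRingSeminorm R where
  toFun x := v (f x)
  map_zero' := by rw [map_zero, map_zero]
  map_one' := by rw [map_one, map_one]
  map_mul' x y := by rw [map_mul, map_mul]
  neg' x := by rw [map_neg, v.map_neg]
  add_le' x y := by
    rw [map_add]
    exact v.add_le _ _

theorem pullbackSeminorm_apply (v : AbsoluteValue S ℝ) (x : R) :
    pullbackSeminorm f v x = v (f x) :=
  rfl

theorem supSeminorm_pullbackSeminorm_pos {ι : Type*} [Finite ι] {x : ι → R} (hx : f ∘ x ≠ 0)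
    (v : AbsoluteValue S ℝ) : 0 < supSeminorm (pullbackSeminorm f v) x := by
  obtain ⟨i, hi⟩ := Function.ne_iff.mp hx
  exact (v.pos hi).trans_le (le_supSeminorm (pullbackSeminorm f v) x i)

theorem log_constBound_pullbackSeminorm [CommRing k] [Algebra k R] (κ : Multiset k)
    (v : AbsoluteValue S ℝ) : Real.log (constBound κ (pullbackSeminorm f v)) =
      (κ.map fun c => Real.posLog (v (f (algebraMap k R c)))).sum := by
  rw [constBound, Real.log_multiset_prod, Multiset.map_map]
  · simp only [Function.comp_apply, pullbackSeminorm_apply, Real.posLog_eq_log_max_one (v.nonneg _)]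
  · simp only [Multiset.mem_map]
    rintro _ ⟨c, -, rfl⟩
    positivity

end Pullback

section LocalToGlobal

open Height AdmissibleAbsValues Function

variable {L : Type*} [Field L] [AdmissibleAbsValues L]

/-- The sum of `g` over the places of `L`, archimedean places being counted with multiplicity. The
nonarchimedean part has the junk value `0` unless `g` vanishes at almost all places. -/
noncomputable def sumPlaces (g : AbsoluteValue L ℝ → ℝ) : ℝ :=
  (archAbsVal.map g).sum + ∑ᶠ v : nonarchAbsVal (K := L), g v

section Sum

variable {g g' : AbsoluteValue L ℝ → ℝ}

theorem mul_sumPlaces (a : ℝ) : a * sumPlaces g = sumPlaces fun v => a * g v := by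
  rw [sumPlaces, mul_add, mul_finsum, ← Multiset.sum_map_mul_left, sumPlaces]

variable (hg : (fun v : nonarchAbsVal (K := L) => g v).HasFiniteSupport)
  (hg' : (fun v : nonarchAbsVal (K := L) => g' v).HasFiniteSupport)

include hg hg'

theorem sumPlaces_add : sumPlaces (fun v => g v + g' v) = sumPlaces g + sumPlaces g' := by
  rw [sumPlaces, Multiset.sum_map_add, finsum_add_distrib hg hg', sumPlaces, sumPlaces,
    add_add_add_comm]

theorem sumPlaces_sub : sumPlaces (fun v => g v - g' v) = sumPlaces g - sumPlaces g' := by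
  rw [sumPlaces, Multiset.sum_map_sub, finsum_sub_distrib hg hg', sumPlaces, sumPlaces,
    add_sub_add_comm]

theorem sumPlaces_mono (h : ∀ v, g v ≤ g' v) : sumPlaces g ≤ sumPlaces g' :=
  add_le_add (Multiset.sum_map_le_sum_map _ _ fun v _ => h v)
    (finsum_le_finsum' hg hg' fun v => h v)

theorem abs_sumPlaces_le (h : ∀ v, |g v| ≤ g' v) : |sumPlaces g| ≤ sumPlaces g' := by
  refine abs_le'.mpr ⟨sumPlaces_mono hg hg' fun v => (abs_le'.mp (h v)).1, ?_⟩
  rw [← neg_one_mul, mul_sumPlaces]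
  refine sumPlaces_mono (hg.fun_comp (g := fun t => -1 * t) (mul_zero _)) hg' fun v => ?_
  rw [neg_one_mul]
  exact (abs_le'.mp (h v)).2

end Sum

section Comparison

variable {k R : Type*} [CommRing k] [CommRing R] [Algebra k R] {f : R →+* L}
  {ι ι' : Type*} [Finite ι] [Finite ι']

theorem hasFiniteSupport_log_supSeminorm {x : ι → R} (hx : f ∘ x ≠ 0) :
    (fun v : nonarchAbsVal (K := L) =>
      Real.log (supSeminorm (pullbackSeminorm f v) x)).HasFiniteSupport := by
  obtain ⟨i, hi⟩ := Function.ne_iff.mp hx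
  have hfin : (⋃ j : {j // f (x j) ≠ 0}, mulSupport
      fun v : nonarchAbsVal (K := L) => v.val (f (x j))).Finite :=
    Set.finite_iUnion fun j => hasFiniteMulSupport j.2
  refine hfin.subset fun v hv => ?_
  by_contra! h
  simp only [Set.mem_iUnion, mem_mulSupport, not_exists, not_not] at h
  have hsup : supSeminorm (pullbackSeminorm f v.val) x = 1 := by
    refine le_antisymm (supSeminorm_le zero_le_one fun j => ?_) ?_
    · rcases eq_or_ne (f (x j)) 0 with hj | hj
      · simp only [pullbackSeminorm_apply, hj, map_zero, zero_le_one]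
      · exact (h ⟨j, hj⟩).le
    · exact (h ⟨i, hi⟩).ge.trans (le_supSeminorm (pullbackSeminorm f v.val) x i)
  exact hv (by simp only [hsup, Real.log_one])

theorem logHeight_eq_sumPlaces {x : ι → R} (hx : f ∘ x ≠ 0) :
    logHeight (f ∘ x) = sumPlaces fun v => Real.log (supSeminorm (pullbackSeminorm f v) x) := by
  have heq : mulHeight (f ∘ x) =
      (archAbsVal.map fun v => supSeminorm (pullbackSeminorm f v) x).prod *
        ∏ᶠ v : nonarchAbsVal (K := L), supSeminorm (pullbackSeminorm f v.val) x :=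
    mulHeight_eq hx
  have hne := heq.symm.trans_ne (mulHeight_ne_zero _)
  rw [logHeight, heq, Real.log_mul (left_ne_zero_of_mul hne) (right_ne_zero_of_mul hne),
    Real.log_multiset_prod, Multiset.map_map,
    Real.log_finprod fun v : nonarchAbsVal => supSeminorm_pullbackSeminorm_pos hx v.val]
  · rfl
  · exact fun a ha h0 => left_ne_zero_of_mul hne (Multiset.prod_eq_zero (h0 ▸ ha))

theorem hasFiniteSupport_posLog (x : L) :
    (fun v : nonarchAbsVal (K := L) => Real.posLog (v.val x)).HasFiniteSupport := by
  rcases eq_or_ne x 0 with rfl | hx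
  · simp [HasFiniteSupport]
  · refine (hasFiniteMulSupport hx).subset fun v hv h => hv ?_
    simp only [h, Real.posLog_one]

theorem sumPlaces_log_constBound (κ : Multiset k) :
    (fun v : nonarchAbsVal (K := L) =>
      Real.log (constBound κ (pullbackSeminorm f v.val))).HasFiniteSupport ∧
    sumPlaces (fun v => Real.log (constBound κ (pullbackSeminorm f v))) =
      (κ.map fun c => logHeight₁ (f (algebraMap k R c))).sum := by
  simp only [log_constBound_pullbackSeminorm]
  induction κ using Multiset.induction_on with
  | empty => simp [sumPlaces, HasFiniteSupport]
  | cons c κ ih =>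
    simp only [Multiset.map_cons, Multiset.sum_cons]
    have hc := hasFiniteSupport_posLog (f (algebraMap k R c))
    refine ⟨hc.add ih.1, ?_⟩
    rw [sumPlaces_add hc ih.1, ih.2, logHeight₁_eq, sumPlaces]

theorem abs_mul_logHeight_sub_le {x : ι → R} {y : ι' → R}
    (hx : f ∘ x ≠ 0) (hy : f ∘ y ≠ 0) {α β : ℝ} (κ : Multiset k)
    (h : ∀ φ : MulRingSeminorm R, |α * Real.log (supSeminorm φ x) - β * Real.log (supSeminorm φ y)|
      ≤ Real.log (constBound κ φ)) :
    |α * logHeight (f ∘ x) - β * logHeight (f ∘ y)| ≤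
      (κ.map fun c => logHeight₁ (f (algebraMap k R c))).sum := by
  have hx' := (hasFiniteSupport_log_supSeminorm hx).fun_comp (g := (α * ·)) (mul_zero α)
  have hy' := (hasFiniteSupport_log_supSeminorm hy).fun_comp (g := (β * ·)) (mul_zero β)
  obtain ⟨hκ, hsum⟩ := sumPlaces_log_constBound (f := f) κ
  rw [logHeight_eq_sumPlaces hx, logHeight_eq_sumPlaces hy, mul_sumPlaces, mul_sumPlaces,
    ← sumPlaces_sub hx' hy', ← hsum]
  exact abs_sumPlaces_le (hx'.sub hy') hκ fun v => h (pullbackSeminorm f v)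

end Comparison

end LocalToGlobal

section HeightExtension

open Height Module NumberField

variable {L M : Type*} [Field L] [NumberField L] [Field M] [NumberField M] [Algebra L M]
  {ι : Type*}

theorem prod_iSup_infinitePlace_eq_prod_embeddings (x : ι → L) :
    ∏ w : InfinitePlace L, (⨆ i, w (x i)) ^ w.mult = ∏ σ : L →+* ℂ, ⨆ i, ‖σ (x i)‖ := by
  classical
  rw [← Finset.prod_fiberwise Finset.univ InfinitePlace.mk]
  refine Finset.prod_congr rfl fun w _ => ?_
  rw [← InfinitePlace.card_filter_mk_eq w, ← Finset.prod_const]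
  refine Finset.prod_congr rfl fun σ hσ => ?_
  rw [← (Finset.mem_filter.mp hσ).2]
  rfl

theorem card_filter_comp_algebraMap_eq (τ : L →+* ℂ) [DecidableEq (L →+* ℂ)] :
    (Finset.univ.filter fun σ : M →+* ℂ => σ.comp (algebraMap L M) = τ).card = finrank L M := by
  let : Algebra L ℂ := τ.toAlgebra
  have : FiniteDimensional L M := Module.Finite.of_restrictScalars_finite ℚ L M
  rw [← AlgHom.card L M ℂ, ← Fintype.card_coe]
  exact Fintype.card_congr
    { toFun := fun σ =>
        { σ.1 with commutes' := fun c => RingHom.congr_fun (Finset.mem_filter.mp σ.2).2 c }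
      invFun := fun σ => ⟨σ.toRingHom, Finset.mem_filter.mpr
        ⟨Finset.mem_univ _, RingHom.ext σ.commutes⟩⟩ }

theorem prod_iSup_infinitePlace_algebraMap (x : ι → L) :
    ∏ w : InfinitePlace M, (⨆ i, w (algebraMap L M (x i))) ^ w.mult =
      (∏ w : InfinitePlace L, (⨆ i, w (x i)) ^ w.mult) ^ finrank L M := by
  classical
  rw [prod_iSup_infinitePlace_eq_prod_embeddings, prod_iSup_infinitePlace_eq_prod_embeddings,
    ← Finset.prod_fiberwise Finset.univ fun σ : M →+* ℂ => σ.comp (algebraMap L M),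
    ← Finset.prod_pow]
  refine Finset.prod_congr rfl fun τ _ => ?_
  rw [← card_filter_comp_algebraMap_eq (M := M) τ, ← Finset.prod_const]
  refine Finset.prod_congr rfl fun σ hσ => ?_
  rw [← (Finset.mem_filter.mp hσ).2]
  rfl

theorem absNorm_span_range_algebraMap (x : ι → 𝓞 L) :
    (Ideal.span (Set.range fun i => algebraMap (𝓞 L) (𝓞 M) (x i))).absNorm =
      (Ideal.span (Set.range x)).absNorm ^ finrank L M := by
  have hmap : Ideal.span (Set.range fun i => algebraMap (𝓞 L) (𝓞 M) (x i)) =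
      (Ideal.span (Set.range x)).map (algebraMap (𝓞 L) (𝓞 M)) := by
    rw [Ideal.map_span, ← Set.range_comp]
    rfl
  rw [hmap, Ideal.absNorm_algebraMap, IsFractionRing.finrank_eq (𝓞 L) L (𝓞 M) M]

variable [Finite ι]

theorem prod_iSup_finitePlace_algebraMap {x : ι → 𝓞 L} (hx : x ≠ 0) :
    ∏ᶠ w : FinitePlace M, ⨆ i, w (algebraMap L M (x i)) =
      (∏ᶠ w : FinitePlace L, ⨆ i, w (x i : L)) ^ finrank L M := by
  have hx' : (fun i => algebraMap (𝓞 L) (𝓞 M) (x i)) ≠ 0 := fun h => hx <| funext fun i =>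
    RingOfIntegers.algebraMap.injective L M (by simpa using congrFun h i)
  have hL := congrArg (· ^ finrank L M) (absNorm_mul_finprod_finitePlace_eq_one hx)
  have hM := absNorm_mul_finprod_finitePlace_eq_one hx'
  simp only [mul_pow, one_pow] at hL
  rw [absNorm_span_range_algebraMap, Nat.cast_pow] at hM
  exact mul_left_cancel₀ (left_ne_zero_of_mul_eq_one hL) (hM.trans hL.symm)

theorem mulHeight_algebraMap_ringOfIntegers {x : ι → 𝓞 L} (hx : x ≠ 0) :
    mulHeight (fun i => algebraMap L M (x i)) =
      mulHeight (fun i => (x i : L)) ^ finrank L M := by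
  obtain ⟨i, hi⟩ := Function.ne_iff.mp hx
  have hL : (fun i => (x i : L)) ≠ 0 := Function.ne_iff.mpr ⟨i, by simpa using hi⟩
  have hM : (fun i => algebraMap L M (x i)) ≠ 0 := Function.ne_iff.mpr ⟨i, by simpa using hi⟩
  rw [NumberField.mulHeight_eq hL, NumberField.mulHeight_eq hM, mul_pow,
    prod_iSup_infinitePlace_algebraMap, prod_iSup_finitePlace_algebraMap hx]

theorem mulHeight_algebraMap (x : ι → L) :
    mulHeight (fun i => algebraMap L M (x i)) = mulHeight x ^ finrank L M := by
  rcases eq_or_ne x 0 with rfl | hx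
  · simp
  obtain ⟨⟨b, hb⟩, hbx⟩ :=
    IsLocalization.exist_integer_multiples_of_finite (nonZeroDivisors (𝓞 L)) x
  choose y hy using hbx
  have hb0 : (b : L) ≠ 0 := by simpa using nonZeroDivisors.ne_zero hb
  have hyx : ∀ i, (y i : L) = b * x i := fun i => by simpa [Algebra.smul_def] using hy i
  have hy0 : y ≠ 0 := by
    rintro rfl
    exact hx (funext fun i => by simpa [hb0] using (hyx i).symm)
  have hint := mulHeight_algebraMap_ringOfIntegers (M := M) hy0
  simp only [hyx, map_mul] at hint
  rwa [← mulHeight_smul_eq_mulHeight x hb0, ← mulHeight_smul_eq_mulHeight _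
    ((map_ne_zero (algebraMap L M)).mpr hb0)]

theorem logHeight_algebraMap_div_finrank (x : ι → L) :
    logHeight (fun i => algebraMap L M (x i)) / finrank ℚ M = logHeight x / finrank ℚ L := by
  have : FiniteDimensional L M := Module.Finite.of_restrictScalars_finite ℚ L M
  have hpos : (finrank L M : ℝ) ≠ 0 := Nat.cast_ne_zero.mpr finrank_pos.ne'
  rw [logHeight_eq_log_mulHeight, mulHeight_algebraMap, Real.log_pow, ← logHeight_eq_log_mulHeight,
    ← finrank_mul_finrank ℚ L M, Nat.cast_mul, mul_comm (finrank ℚ L : ℝ),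
    mul_div_mul_left _ _ hpos]

theorem logHeight₁_algebraMap_div_finrank (c : L) :
    logHeight₁ (algebraMap L M c) / finrank ℚ M = logHeight₁ c / finrank ℚ L := by
  rw [logHeight₁_eq_logHeight, logHeight₁_eq_logHeight,
    ← logHeight_algebraMap_div_finrank (L := L) (M := M)]
  congr 2
  funext i
  fin_cases i <;> simp

theorem absLogHeight_eq {K : Type*} [Field K] [NumberField K]
    (L : IntermediateField K (AlgebraicClosure K)) [NumberField L] (x : ι → L) :
    absLogHeight (fun i => (x i : AlgebraicClosure K)) = logHeight x / finrank ℚ L := by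
  have := numberField_adjoin_range fun i => (x i : AlgebraicClosure K)
  have hle : IntermediateField.adjoin K (Set.range fun i => (x i : AlgebraicClosure K)) ≤ L :=
    IntermediateField.adjoin_le_iff.mpr (Set.range_subset_iff.mpr fun i => (x i).2)
  let := (IntermediateField.inclusion hle).toAlgebra
  exact (logHeight_algebraMap_div_finrank (M := L) fun i =>
    (⟨x i, IntermediateField.subset_adjoin K _ ⟨i, rfl⟩⟩ :
      IntermediateField.adjoin K (Set.range fun i => (x i : AlgebraicClosure K)))).symm

end HeightExtension

section CanonicalHeight

open Height

variable {R L : Type*} [CommRing R] [Field L] [AdmissibleAbsValues L] {P Q : R[X]}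

theorem exists_tendsto_logHeight_ratLift_iterate (f : R →+* L) (hd : 2 ≤ ratDegree P Q)
    (hres : IsUnit (resultant P Q)) (hP : IsUnit P.leadingCoeff) (hQ : IsUnit Q.leadingCoeff)
    {x : Fin 2 → R} (hx : IsCoprime (x 0) (x 1)) :
    ∃ H : ℝ, Tendsto (fun n : ℕ => logHeight (f ∘ (ratLift P Q)^[n] x) / (ratDegree P Q : ℝ) ^ n)
      atTop (𝓝 H) := by
  have hd1 : 1 ≤ ratDegree P Q := one_le_two.trans hd
  have hcop := isCoprime_ratLift_iterate hd1 hres hP hQ hx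
  have hne : ∀ n, f ∘ (ratLift P Q)^[n] x ≠ 0 := fun n => ((hcop n).map f).ne_zero
  obtain ⟨κ, hκ⟩ := logBounded_ratLift (φ := fun t : MulRingSeminorm R × ℕ => t.1) hd1 hres hP hQ
    fun t => hcop t.2
  simp only [← Function.iterate_succ_apply' (ratLift P Q)] at hκ
  refine exists_tendsto_div_pow (C := (κ.map fun c => logHeight₁ (f (algebraMap R R c))).sum)
    (by exact_mod_cast hd) fun n => ?_
  simpa only [one_mul] using abs_mul_logHeight_sub_le (α := 1) (hne (n + 1)) (hne n) κ fun φ => by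
    simpa only [one_mul] using hκ (φ, n)

end CanonicalHeight

section GeometricPoints

open Height Module

variable {K F : Type*} [Field K] [Field F] [Algebra K F] {η : Place K F}

theorem GeneratesMultiple.comp_ne_zero {m r : ℕ} {s : Fin r → η.regularRing}
    (hs : GeneratesMultiple η m s) (hF : IsCurveFunctionField K F) {L : Type*} [Field L]
    (f : η.regularRing →+* L) : f ∘ s ≠ 0 := by
  classical
  intro h0
  refine (hs.supSeminorm_pos hF (pullbackSeminorm f AbsoluteValue.trivial)).not_ge ?_
  exact supSeminorm_le le_rfl fun i =>
    (congrArg AbsoluteValue.trivial (congrFun h0 i)).trans_le (map_zero _).le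

namespace Place.AffinePoint

/-- The field of values at the geometric point `l` of the functions regular there; it is the residue
field of `l.place`, embedded in the algebraic closure of `K`. -/
noncomputable def field (l : η.AffinePoint) : IntermediateField K (AlgebraicClosure K) :=
  l.hom.range.toIntermediateField' (Subalgebra.isField_of_algebraic _)

/-- Evaluation at the geometric point `l`, as a map to the field of values at `l`. -/
noncomputable def evalField (l : η.AffinePoint) : η.regularRing →ₐ[K] l.field :=
  l.eval.codRestrict l.field.toSubalgebra fun x =>
    ⟨Subalgebra.inclusion (regularRing_le l.ne) x, rfl⟩

theorem finiteDimensional_field (hF : IsCurveFunctionField K F) (l : η.AffinePoint) :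
    FiniteDimensional K l.field := by
  obtain ⟨t, ht⟩ := IsDiscreteValuationRing.exists_irreducible l.place.ring
  exact hF.finite_range (transcendental_of_not_isUnit ht.ne_zero ht.not_isUnit) l.hom

variable [NumberField K]

theorem numberField_field (hF : IsCurveFunctionField K F) (l : η.AffinePoint) :
    NumberField l.field :=
  have := l.finiteDimensional_field hF
  NumberField.of_module_finite K _

theorem absLogHeight_eval_comp {ι : Type*} [Finite ι] (l : η.AffinePoint) [NumberField l.field]
    (x : ι → η.regularRing) :
    absLogHeight (l.eval ∘ x) = logHeight (l.evalField ∘ x) / finrank ℚ l.field :=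
  absLogHeight_eq l.field (l.evalField ∘ x)

theorem abs_mul_absLogHeight_sub_le (hF : IsCurveFunctionField K F) (l : η.AffinePoint)
    {ι ι' : Type*} [Finite ι] [Finite ι'] {x : ι → η.regularRing} {y : ι' → η.regularRing}
    (hx : l.evalField ∘ x ≠ 0) (hy : l.evalField ∘ y ≠ 0) {α β : ℝ} (κ : Multiset K)
    (h : ∀ φ : MulRingSeminorm η.regularRing,
      |α * Real.log (supSeminorm φ x) - β * Real.log (supSeminorm φ y)| ≤
        Real.log (constBound κ φ)) :
    |α * absLogHeight (l.eval ∘ x) - β * absLogHeight (l.eval ∘ y)| ≤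
      (κ.map fun c => logHeight₁ c / finrank ℚ K).sum := by
  have := l.numberField_field hF
  have key := abs_mul_logHeight_sub_le (f := (l.evalField : η.regularRing →+* l.field)) hx hy κ h
  rw [l.absLogHeight_eval_comp, l.absLogHeight_eval_comp, mul_div_assoc', mul_div_assoc',
    ← sub_div, abs_div, Nat.abs_cast]
  refine (div_le_div_of_nonneg_right key (Nat.cast_nonneg _)).trans_eq ?_
  simp only [← Multiset.sum_map_div, RingHom.coe_coe, AlgHom.commutes,
    logHeight₁_algebraMap_div_finrank]

end Place.AffinePoint

end GeometricPoints

section FunctionFieldHeight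

open WithZeroMulInt

variable {K F : Type*} [Field K] [Field F] [Algebra K F]

theorem log_toNNReal {e : NNReal} (he : e ≠ 0) (n : ℤᵐ⁰) :
    Real.log (toNNReal he n) = WithZero.log n * Real.log e := by
  induction n using WithZero.expRecOn with
  | zero => simp
  | exp n =>
    rw [WithZero.log_exp, ← Real.log_zpow, ← NNReal.coe_zpow]
    rfl

namespace Place

theorem one_lt_toNNReal_exp_one : 1 < (Real.exp 1).toNNReal :=
  Real.one_lt_toNNReal.mpr (Real.one_lt_exp_iff.mpr one_pos)

/-- The multiplicative seminorm `x ↦ exp (- ord_η x)` on the functions that are regular away from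
`η`. -/
noncomputable def poleSeminorm (η : Place K F) : MulRingSeminorm η.regularRing :=
  pullbackSeminorm (algebraMap η.regularRing F)
    ((IsDiscreteValuationRing.maximalIdeal η.ring).adicAbv one_lt_toNNReal_exp_one)

variable {η : Place K F}

theorem poleSeminorm_apply (x : η.regularRing) :
    η.poleSeminorm x = toNNReal one_lt_toNNReal_exp_one.ne_zero (η.val (x : F)) :=
  rfl

theorem constBound_poleSeminorm (κ : Multiset K) : constBound κ η.poleSeminorm = 1 := by
  refine Multiset.prod_eq_one fun _ hc => ?_
  obtain ⟨c, -, rfl⟩ := Multiset.mem_map.mp hc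
  rcases eq_or_ne c 0 with rfl | hc0
  · simp
  · rw [poleSeminorm_apply, Subalgebra.coe_algebraMap, η.val_algebraMap hc0, map_one,
      NNReal.coe_one, max_self]

section

variable {ι : Type*} [Fintype ι] (x : ι → η.regularRing)

theorem supSeminorm_poleSeminorm : supSeminorm η.poleSeminorm x =
    toNNReal one_lt_toNNReal_exp_one.ne_zero (Finset.univ.sup fun i => η.val (x i : F)) := by
  have hmono := (toNNReal_strictMono one_lt_toNNReal_exp_one).monotone
  refine le_antisymm (supSeminorm_le (NNReal.coe_nonneg _) fun i => NNReal.coe_le_coe.mpr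
    (hmono (Finset.le_sup (f := fun i => η.val (x i : F)) (Finset.mem_univ i)))) ?_
  rcases isEmpty_or_nonempty ι with _ | _
  · simpa using supSeminorm_nonneg _ _
  · obtain ⟨i, -, hi⟩ := Finset.exists_mem_eq_sup Finset.univ Finset.univ_nonempty
      fun i => η.val (x i : F)
    rw [hi]
    exact le_supSeminorm η.poleSeminorm x i

theorem log_supSeminorm_poleSeminorm : Real.log (supSeminorm η.poleSeminorm x) =
    WithZero.log (Finset.univ.sup fun i => η.val (x i : F)) := by
  rw [supSeminorm_poleSeminorm, log_toNNReal, Real.coe_toNNReal _ (Real.exp_pos 1).le,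
    Real.log_exp, mul_one]

end

theorem functionFieldHeight_of_isCoprime {x : Fin 2 → η.regularRing} (hx : IsCoprime (x 0) (x 1)) :
    functionFieldHeight K (fun i => (x i : F)) =
      η.degree * Real.log (supSeminorm η.poleSeminorm x) := by
  rw [log_supSeminorm_poleSeminorm]
  refine finsum_eq_single _ η fun p hp => ?_
  rw [le_antisymm (Finset.sup_le fun i _ => val_coe_le_one hp (x i))
    (one_le_sup_val_of_isCoprime hp hx), WithZero.log_one, Int.cast_zero, mul_zero]

end Place

end FunctionFieldHeight

section CanonicalHeights

variable {K F : Type*} [Field K] [Field F] [Algebra K F] {η : Place K F}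

theorem IsNonzeroConstant.isUnit {R : Type*} [CommRing R] [Algebra K R] {x : R}
    (h : IsNonzeroConstant K x) : IsUnit x := by
  obtain ⟨t, ht, rfl⟩ := h
  exact (IsUnit.mk0 t ht).map (algebraMap K R)

section

variable {R k : Type*} [CommRing R] [Field k] {P Q : R[X]} (f : R →+* k)
  (hP : IsUnit P.leadingCoeff) (hQ : IsUnit Q.leadingCoeff) (a b : R)
include hP hQ

theorem ratLift_map_iterate_pair (n : ℕ) :
    (ratLift (P.map f) (Q.map f))^[n] ![f a, f b] = f ∘ (ratLift P Q)^[n] ![a, b] := by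
  rw [← ratLift_map_iterate f hP hQ]
  congr 1
  ext i
  fin_cases i <;> rfl

theorem hasCanonicalHeight_map_iff (ht : (Fin 2 → k) → ℝ) (H : ℝ) :
    HasCanonicalHeight ht (P.map f) (Q.map f) ![f a, f b] H ↔
      Tendsto (fun n => ht (f ∘ (ratLift P Q)^[n] ![a, b]) / (ratDegree P Q : ℝ) ^ n) atTop
        (𝓝 H) := by
  simp only [HasCanonicalHeight, ratDegree_map f hP hQ, ratLift_map_iterate_pair f hP hQ]

end

theorem exists_lt_deg_of_not_bddAbove {P Q : η.regularRing[X]} (hP : IsUnit P.leadingCoeff)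
    (hQ : IsUnit Q.leadingCoeff) {a b : η.regularRing}
    (h : ¬ BddAbove (Set.range fun n : ℕ =>
      let x : Fin 2 → F := (ratLift (P.map (algebraMap η.regularRing F))
        (Q.map (algebraMap η.regularRing F)))^[n] ![(a : F), (b : F)]
      η.deg (x 0 / x 1))) (D : ℕ) :
    ∃ n : ℕ, (D : ℤ) < η.deg (((ratLift P Q)^[n] ![a, b] 0 : η.regularRing) /
      ((ratLift P Q)^[n] ![a, b] 1 : η.regularRing)) := by
  obtain ⟨_, ⟨n, rfl⟩, hn⟩ := not_bddAbove_iff.mp h (D : ℤ)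
  have hmap := ratLift_map_iterate_pair (algebraMap η.regularRing F) hP hQ a b n
  exact ⟨n, hn.trans_eq (congrArg (fun x : Fin 2 → F => η.deg (x 0 / x 1)) hmap)⟩

variable {P Q : η.regularRing[X]} (hd : 2 ≤ ratDegree P Q) (hres : IsUnit (resultant P Q))
  (hP : IsUnit P.leadingCoeff) (hQ : IsUnit Q.leadingCoeff) {a b : η.regularRing}
  (hab : IsCoprime a b)
include hd hres hP hQ hab

theorem hasCanonicalHeight_functionFieldHeight_iff (H : ℝ) :
    HasCanonicalHeight (functionFieldHeight K) (P.map (algebraMap η.regularRing F))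
      (Q.map (algebraMap η.regularRing F)) ![(a : F), (b : F)] H ↔
    Tendsto (fun n => η.degree *
      (Real.log (supSeminorm η.poleSeminorm ((ratLift P Q)^[n] ![a, b])) /
        (ratDegree P Q : ℝ) ^ n)) atTop (𝓝 H) := by
  refine (hasCanonicalHeight_map_iff (algebraMap η.regularRing F) hP hQ a b _ H).trans
    (tendsto_congr fun n => ?_)
  rw [← mul_div_assoc, ← Place.functionFieldHeight_of_isCoprime
    (isCoprime_ratLift_iterate (one_le_two.trans hd) hres hP hQ hab n)]
  rfl

theorem exists_hasCanonicalHeight_functionFieldHeight : ∃ H : ℝ,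
    HasCanonicalHeight (functionFieldHeight K) (P.map (algebraMap η.regularRing F))
      (Q.map (algebraMap η.regularRing F)) ![(a : F), (b : F)] H := by
  have hd1 : 1 ≤ ratDegree P Q := one_le_two.trans hd
  simp only [hasCanonicalHeight_functionFieldHeight_iff hd hres hP hQ hab]
  obtain ⟨κ, hκ⟩ := logBounded_ratLift (φ := fun _ : ℕ => η.poleSeminorm) hd1 hres hP hQ
    (isCoprime_ratLift_iterate hd1 hres hP hQ (x := ![a, b]) hab)
  simp only [← Function.iterate_succ_apply' (ratLift P Q)] at hκ
  obtain ⟨H, hH⟩ := exists_tendsto_div_pow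
    (u := fun n => Real.log (supSeminorm η.poleSeminorm ((ratLift P Q)^[n] ![a, b])))
    (q := ratDegree P Q) (by exact_mod_cast hd) hκ
  exact ⟨η.degree * H, hH.const_mul _⟩

theorem exists_hasCanonicalHeight_absLogHeight [NumberField K] (hF : IsCurveFunctionField K F)
    (l : η.AffinePoint) : ∃ H : ℝ,
    HasCanonicalHeight absLogHeight (P.map (l.eval : η.regularRing →+* AlgebraicClosure K))
      (Q.map (l.eval : η.regularRing →+* AlgebraicClosure K)) ![l.eval a, l.eval b] H := by
  have := l.numberField_field hF
  obtain ⟨H, hH⟩ := exists_tendsto_logHeight_ratLift_iterate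
    (l.evalField : η.regularRing →+* l.field) hd hres hP hQ (x := ![a, b]) hab
  refine ⟨H / Module.finrank ℚ l.field, (hasCanonicalHeight_map_iff
    (l.eval : η.regularRing →+* AlgebraicClosure K) hP hQ a b _ _).mpr ?_⟩
  refine (hH.div_const _).congr fun n => ?_
  rw [div_right_comm]
  exact congrArg (· / _) (l.absLogHeight_eval_comp _).symm

variable (hF : IsCurveFunctionField K F)
  (hinf : SuperattractingAtInfinity (P.map (algebraMap η.regularRing F))
    (Q.map (algebraMap η.regularRing F)))
  (hdeg : ∀ D : ℕ, ∃ n : ℕ, (D : ℤ) < η.deg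
    (((ratLift P Q)^[n] ![a, b] 0 : η.regularRing) /
      ((ratLift P Q)^[n] ![a, b] 1 : η.regularRing)))
  {m r : ℕ} {s : Fin r → η.regularRing} (hm : m ≠ 0) (hs : GeneratesMultiple η m s)
include hF hinf hdeg hm hs

theorem exists_abs_log_iterate_sub_le {H : ℝ}
    (hH : HasCanonicalHeight (functionFieldHeight K) (P.map (algebraMap η.regularRing F))
      (Q.map (algebraMap η.regularRing F)) ![(a : F), (b : F)] H) :
    ∃ (κ : Multiset K) (e : ℕ → ℕ), Tendsto e atTop atTop ∧
      ∀ (φ : MulRingSeminorm η.regularRing) (j : ℕ),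
        |η.degree * (Real.log (supSeminorm φ ((ratLift P Q)^[e j] ![a, b])) /
            (ratDegree P Q : ℝ) ^ e j) - H / m * Real.log (supSeminorm φ s)| ≤
          Real.log (constBound κ φ) := by
  obtain ⟨h, e, he, κ, hκ⟩ := exists_logBounded_iterate_sub id hF hm hs hd hres hP hQ hinf hab hdeg
  have hlogs : Real.log (supSeminorm η.poleSeminorm s) = m := by
    rw [Place.log_supSeminorm_poleSeminorm, hs.2, WithZero.log_exp, Int.cast_natCast]
  have hpole : Tendsto (fun j => Real.log (supSeminorm η.poleSeminorm
      ((ratLift P Q)^[e j] ![a, b])) / (ratDegree P Q : ℝ) ^ e j) atTop (𝓝 h) := by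
    refine tendsto_const_nhds.congr fun j => (sub_eq_zero.mp (abs_nonpos_iff.mp ?_)).symm
    simpa only [id, Place.constBound_poleSeminorm, Real.log_one, hlogs,
      div_mul_cancel₀ h (Nat.cast_ne_zero.mpr hm)] using hκ (η.poleSeminorm, j)
  have hHh : H = η.degree * h := tendsto_nhds_unique
    (((hasCanonicalHeight_functionFieldHeight_iff hd hres hP hQ hab H).mp hH).comp he)
    (hpole.const_mul _)
  refine ⟨η.degree • κ, e, he, fun φ j => ?_⟩
  rw [hHh, mul_div_assoc, mul_assoc, ← mul_sub, abs_mul, Nat.abs_cast, constBound_nsmul,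
    Real.log_pow]
  exact mul_le_mul_of_nonneg_left (hκ (φ, j)) (Nat.cast_nonneg _)

theorem exists_abs_canonicalHeight_sub_le [NumberField K] {H : ℝ}
    (hH : HasCanonicalHeight (functionFieldHeight K) (P.map (algebraMap η.regularRing F))
      (Q.map (algebraMap η.regularRing F)) ![(a : F), (b : F)] H)
    {hlam : η.AffinePoint → ℝ} (hlam' : ∀ l : η.AffinePoint, HasCanonicalHeight absLogHeight
      (P.map (l.eval : η.regularRing →+* AlgebraicClosure K))
      (Q.map (l.eval : η.regularRing →+* AlgebraicClosure K)) ![l.eval a, l.eval b] (hlam l)) :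
    ∃ C : ℝ, ∀ l : η.AffinePoint,
      |η.degree * hlam l - H / m * absLogHeight (l.eval ∘ s)| ≤ C := by
  obtain ⟨κ, e, he, hκ⟩ := exists_abs_log_iterate_sub_le hd hres hP hQ hab hF hinf hdeg hm hs hH
  refine ⟨(κ.map fun c => Height.logHeight₁ c / Module.finrank ℚ K).sum, fun l => ?_⟩
  have hl := (hasCanonicalHeight_map_iff (l.eval : η.regularRing →+* AlgebraicClosure K)
    hP hQ a b _ _).mp (hlam' l)
  refine le_of_tendsto (((hl.comp he).const_mul _).sub_const _).abs
    (Eventually.of_forall fun j => ?_)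
  have hcop := isCoprime_ratLift_iterate (one_le_two.trans hd) hres hP hQ (x := ![a, b]) hab (e j)
  have hbound := l.abs_mul_absLogHeight_sub_le hF (α := η.degree * ((ratDegree P Q : ℝ) ^ e j)⁻¹)
    (β := H / m) (hcop.map (l.evalField : η.regularRing →+* l.field)).ne_zero
    (hs.comp_ne_zero hF (l.evalField : η.regularRing →+* l.field)) κ fun φ => by
      simpa only [div_eq_inv_mul, mul_assoc] using hκ φ j
  simpa only [div_eq_inv_mul, mul_assoc, RingHom.coe_coe, Function.comp_apply] using hbound

end CanonicalHeights

theorem mainTheorem5_general {K F : Type*} [Field K] [NumberField K] [Field F] [Algebra K F]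
    (hF : IsCurveFunctionField K F) (η : Place K F)
    (P Q : η.regularRing[X]) (hd : 2 ≤ ratDegree P Q)
    (hres : IsNonzeroConstant K (resultant P Q))
    (hP : IsNonzeroConstant K P.leadingCoeff) (hQ : IsNonzeroConstant K Q.leadingCoeff)
    (hinf : SuperattractingAtInfinity
      (P.map (algebraMap η.regularRing F)) (Q.map (algebraMap η.regularRing F)))
    (a b : η.regularRing) (hab : Ideal.span {a, b} = ⊤)
    (hc : ¬ BddAbove (Set.range fun n : ℕ =>
      let x : Fin 2 → F := (ratLift (P.map (algebraMap η.regularRing F))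
        (Q.map (algebraMap η.regularRing F)))^[n] ![(a : F), (b : F)]
      η.deg (x 0 / x 1))) :
    ∃ (hfc : ℝ) (hlam : η.AffinePoint → ℝ),
      HasCanonicalHeight (functionFieldHeight K)
        (P.map (algebraMap η.regularRing F)) (Q.map (algebraMap η.regularRing F))
        ![(a : F), (b : F)] hfc ∧
      (∀ l : η.AffinePoint, HasCanonicalHeight absLogHeight
        (P.map (l.eval : η.regularRing →+* AlgebraicClosure K))
        (Q.map (l.eval : η.regularRing →+* AlgebraicClosure K))
        ![l.eval a, l.eval b] (hlam l)) ∧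
      ∀ h : η.AffinePoint → ℝ, IsWeilHeight η h →
        ∃ C : ℝ, ∀ l : η.AffinePoint, |η.degree * hlam l - hfc * h l| ≤ C := by
  have hres := hres.isUnit
  have hP := hP.isUnit
  have hQ := hQ.isUnit
  have hab : IsCoprime a b := Ideal.mem_span_pair.mp ((Ideal.eq_top_iff_one _).mp hab)
  obtain ⟨hfc, hfun⟩ := exists_hasCanonicalHeight_functionFieldHeight hd hres hP hQ hab
  choose hlam hgeo using exists_hasCanonicalHeight_absLogHeight hd hres hP hQ hab hF
  refine ⟨hfc, hlam, hfun, hgeo, ?_⟩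
  rintro h ⟨m, r, s, hm, hs, C, hC⟩
  have hdeg := exists_lt_deg_of_not_bddAbove hP hQ hc
  obtain ⟨B, hB⟩ := exists_abs_canonicalHeight_sub_le hd hres hP hQ hab hF hinf hdeg
    (Nat.one_le_iff_ne_zero.mp hm) hs hfun hgeo
  refine ⟨B + |hfc| * C, fun l => (abs_sub_le _ _ _).trans (add_le_add (hB l) ?_)⟩
  rw [div_mul_eq_mul_div, mul_div_assoc, ← mul_sub, abs_mul, abs_sub_comm]
  exact mul_le_mul_of_nonneg_left (hC l) (abs_nonneg _)

theorem mainTheorem5 {K F : Type*} [Field K] [NumberField K] [Field F] [Algebra K F]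
    (_hF : IsCurveFunctionField K F) (η : Place K F) (_hη : η.degree = 1)
    (P Q : η.regularRing[X]) (_hd : 2 ≤ ratDegree P Q)
    (_hres : IsNonzeroConstant K (resultant P Q))
    (_hP : IsNonzeroConstant K P.leadingCoeff) (_hQ : IsNonzeroConstant K Q.leadingCoeff)
    (_hinf : SuperattractingAtInfinity
      (P.map (algebraMap η.regularRing F)) (Q.map (algebraMap η.regularRing F)))
    (a b : η.regularRing) (_hab : Ideal.span {a, b} = ⊤)
    (_hc : ¬ BddAbove (Set.range fun n : ℕ =>
      let x : Fin 2 → F := (ratLift (P.map (algebraMap η.regularRing F))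
        (Q.map (algebraMap η.regularRing F)))^[n] ![(a : F), (b : F)]
      η.deg (x 0 / x 1))) :
    ∃ (hfc : ℝ) (hlam : η.AffinePoint → ℝ),
      HasCanonicalHeight (functionFieldHeight K)
        (P.map (algebraMap η.regularRing F)) (Q.map (algebraMap η.regularRing F))
        ![(a : F), (b : F)] hfc ∧
      (∀ l : η.AffinePoint, HasCanonicalHeight absLogHeight
        (P.map (l.eval : η.regularRing →+* AlgebraicClosure K))
        (Q.map (l.eval : η.regularRing →+* AlgebraicClosure K))
        ![l.eval a, l.eval b] (hlam l)) ∧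
      ∀ h : η.AffinePoint → ℝ, IsWeilHeight η h →
        ∃ C : ℝ, ∀ l : η.AffinePoint, |hlam l - hfc * h l| ≤ C := by
  simpa only [_hη, Nat.cast_one, one_mul] using
    mainTheorem5_general _hF η P Q _hd _hres _hP _hQ _hinf a b _hab _hc
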